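/- Fix $0\le\alpha,\beta,\gamma\le 1/2$, let $\mathrm{dist}$ be the Hamming distance on $\mathbb F_2^n$ and $H(p)=-p\log_2 p-(1-p)\log_2(1-p)$. Write $f\doteq g$ if $f(n)\le 2^{o(n)}g(n)$ and $g(n)\le 2^{o(n)}f(n)$, and $f\gtrsim 1$ if $f(n)\ge 2^{-o(n)}$. Let $L$ be a list of $|L|$ independent uniform vectors of $\mathbb F_2^n$, $1\le |L|\le 2^n$, and let $C=C_1\times\dots\times C_\ell\subset\mathbb F_2^n$ be a random product code: $\mathbb F_2^n$ is cut into $\ell$ consecutive blocks, $C_i$ is a nonempty list of independent uniform vectors of the $i$-th block, $\sum_i|C_i|\le 2^{o(n)}$, $C$ is independent of $L$, and $|C|=\prod_i|C_i|$ (with multiplicity). The bucket of $c$ is $B_c=\{v\in L:\mathrm{dist}(v,c)\le\alpha n\}$. Locality-sensitive filtering uses the following routines. Insert$(x)$ (respectively Remove$(x)$) adds $x$ to (deletes $x$ from) the buckets of all $c\in C$ with $\mathrm{dist}(c,x)\le\alpha n$; preprocessing writes down $C_1,\dots,C_\ell$ and inserts all $v\in L$ into an empty data structure; Query$(q)$ goes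 through the buckets of all $c\in C$ with $\mathrm{dist}(c,q)\le\beta n$ and returns the vectors $x$ found there with $\mathrm{dist}(x,q)\le\gamma n$. Buckets are stored as binary search trees, and close filter vectors are found by decoding block after block, discarding partial choices that cannot be completed to a close one. Cost is the number of elementary steps; expectations are over $C$ and $L$. Then: 1. The expected bucket size satisfies $\mathbb E|B_c|\doteq |L|\cdot 2^{(H(\alpha)-1)n}$, for every $c\in\mathbb F_2^n$. 2. If $|C|\,2^{(H(\alpha)-1)n}\gtrsim 1$, each Update (an Insert or a Remove, of any vector, in any state of the data structure) has expected cost $T_{\mathrm{Upd}}\doteq|C|\cdot 2^{(H(\alpha)-1)n}$. 3. Under the same condition preprocessing has expected cost $T_{\mathrm{Prep}}\doteq|L|\cdot|C|\cdot 2^{(H(\alpha)-1)n}$. 4. If $|C|\,2^{(H(\beta)-1)n}\gtrsim1$ and $|L|\,2^{(H(\alpha)-1)n}\gtrsim 1$, each Query (of any vector $q$, after preprocessing $L$) has expected cost $T_{\mathrm{Query}}\doteq|C|\cdot 2^{(H(\beta)-1)n}\cdot\mathbb E|B_c|$. Without the conditions in 2–4, $T_{\mathrm{Upd}}\doteq\max(1,|C|2^{(H(\alpha)-1)n})$,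 $T_{\mathrm{Prep}}\doteq|L|\max(1,|C|2^{(H(\alpha)-1)n})$ and $T_{\mathrm{Query}}\doteq\max\bigl(1,\ |C|2^{(H(\beta)-1)n}\max(1,\mathbb E|B_c|)\bigr)$. -/

import Mathlib

open Filter Asymptotics
open scoped BigOperators

/-! ## Step-counted computations -/

/-- A computation returning `val` after `cost` elementary steps. -/
structure Timed (A : Type) where
  val : A
  cost : ℕ

namespace Timed

/-- Sequencing adds the costs; returning a value is free. -/
instance : Monad Timed where
  pure a := ⟨a, 0⟩
  bind m f := ⟨(f m.val).val, m.cost + (f m.val).cost⟩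

/-- Spend `k` elementary steps. -/
def tick (k : ℕ) : Timed Unit := ⟨(), k⟩

end Timed

open Timed (tick)

namespace LSF

/-- Bit strings, as the routines read and write them. -/
abbrev Word := List (ZMod 2)

/-! ## Binary search trees for sets of bit strings -/

/-- A binary tree representing a finite set of bit strings of equal length: branch according to the
successive bits (left for `0`, right for `1`); `leaf` is the set containing just the empty string. -/
inductive BitTree where
  | empty : BitTree
  | leaf : BitTree
  | node : BitTree → BitTree → BitTree

namespace BitTree

/-- The left subtree. -/
def left : BitTree → BitTree
  | node l _ => l
  | _ => empty

/-- The right subtree. -/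
def right : BitTree → BitTree
  | node _ r => r
  | _ => empty

/-- Join two subtrees, without keeping a branch on which nothing is stored. -/
def join : BitTree → BitTree → BitTree
  | empty, empty => empty
  | l, r => node l r

/-- Add a string to the set. -/
def add : Word → BitTree → Timed BitTree
  | [], _ => do
      tick 1
      pure leaf
  | b :: w, t => do
      tick 1
      if b = 0 then do
        let l ← add w t.left
        pure (node l t.right)
      else do
        let r ← add w t.right
        pure (node t.left r)

/-- Delete a string from the set (nothing happens if it is not there). -/
def delete : Word → BitTree → Timed BitTree
  | _, empty => do
      tick 1
      pure empty
  | [], _ => do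
      tick 1
      pure empty
  | b :: w, t => do
      tick 1
      if b = 0 then do
        let l ← delete w t.left
        pure (join l t.right)
      else do
        let r ← delete w t.right
        pure (join t.left r)

/-- The set of all `v` such that `w ++ v` is stored. -/
def find : Word → BitTree → Timed BitTree
  | [], t => do
      tick 1
      pure t
  | b :: w, t => do
      tick 1
      if b = 0 then find w t.left else find w t.right

/-- List all stored strings. A step is charged for every tree node, and for every bit written. -/
def toList : BitTree → Timed (List Word)
  | empty => do
      tick 1
      pure []
  | leaf => do
      tick 1
      pure [[]]
  | node l r => do
      let u ← toList l
      let v ← toList r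
      tick (1 + u.length + v.length)
      pure (u.map (fun w => 0 :: w) ++ v.map (fun w => 1 :: w))

end BitTree

/-! ## Finding all filter vectors close to a given point

The set of filter vectors is the Cartesian product of `ℓ` short codes. It is given to the routines as
the list of the short codes, each of them with its block length: `[(m₁, C₁), …, (m_ℓ, C_ℓ)]`; the
filter vectors are the concatenations `c₁ ++ ⋯ ++ c_ℓ` with `cᵢ ∈ Cᵢ`. -/

/-- The list of short codes, each with its block length. -/
abbrev Codes := List (ℕ × List Word)

/-- The Hamming distance, computed bit by bit. -/
def dist : Word → Word → Timed ℕ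
  | a :: v, b :: w => do
      tick 1
      let d ← dist v w
      pure (if a = b then d else d + 1)
  | _, _ => pure 0

/-- Pair every codeword of one short code with its distance to `x`. -/
def distRow (x : Word) : List Word → Timed (List (Word × ℕ))
  | [] => pure []
  | c :: cs => do
      tick 1
      let d ← dist c x
      let row ← distRow x cs
      pure ((c, d) :: row)

/-- Cut `x` into blocks and decode every block: all codewords with their distances. -/
def distTable : Codes → Word → Timed (List (List (Word × ℕ)))
  | [], _ => pure []
  | (m, cs) :: K, x => do
      tick (m + 1)
      let row ← distRow (x.take m) cs
      let rows ← distTable K (x.drop m)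
      pure (row :: rows)

/-- The smallest distance in a nonempty row. -/
def minRow : List (Word × ℕ) → Timed ℕ
  | [] => pure 0
  | [p] => do
      tick 1
      pure p.2
  | p :: q :: row => do
      tick 1
      let m ← minRow (q :: row)
      pure (min p.2 m)

/-- The smallest total distance that can be attained by choosing one codeword in every row. -/
def minTotal : List (List (Word × ℕ)) → Timed ℕ
  | [] => pure 0
  | row :: rows => do
      tick 1
      let m ← minRow row
      let s ← minTotal rows
      pure (m + s)

/-- Run `f` on all entries of a row and concatenate the outputs. -/
def collect (f : Word × ℕ → Timed (List Word)) : List (Word × ℕ) → Timed (List Word)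
  | [] => pure []
  | p :: row => do
      tick 1
      let u ← f p
      let v ← collect f row
      tick u.length
      pure (u ++ v)

/-- All concatenations of codewords, one from every row, of total distance at most `r`. The codewords
are chosen block after block, and a partial choice is discarded as soon as the remaining blocks cannot
bring it within distance `r`. -/
def enumerate : List (List (Word × ℕ)) → ℕ → Timed (List Word)
  | [], _ => do
      tick 1
      pure [[]]
  | row :: rows, r => do
      let m ← minTotal rows
      collect (fun p =>
        if p.2 + m ≤ r then do
          let ws ← enumerate rows (r - p.2)
          tick (ws.length * (p.1.length + 1))
          pure (ws.map (fun w => p.1 ++ w))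
        else pure []) row

/-- All filter vectors within distance `r` of `x`. -/
def closeFilters (K : Codes) (r : ℕ) (x : Word) : Timed (List Word) := do
  tick 1
  let rows ← distTable K x
  let m ← minTotal rows
  if m ≤ r then enumerate rows r else pure []

/-! ## The routines

The data structure stores every vector `v` of the bucket of a filter vector `c` as the string
`c ++ v` of a binary tree, so that the bucket of `c` is the subtree below `c`. The radii are those of
unnormalised Hamming distances. -/

/-- Add `x` to the buckets of all listed filter vectors. -/
def addToBuckets (x : Word) : List Word → BitTree → Timed BitTree
  | [], D => pure D
  | c :: cs, D => do
      tick (c.length + 1)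
      let D' ← BitTree.add (c ++ x) D
      addToBuckets x cs D'

/-- Delete `x` from the buckets of all listed filter vectors. -/
def deleteFromBuckets (x : Word) : List Word → BitTree → Timed BitTree
  | [], D => pure D
  | c :: cs, D => do
      tick (c.length + 1)
      let D' ← BitTree.delete (c ++ x) D
      deleteFromBuckets x cs D'

/-- Insert (update the data structure with) `x`; `ra` is the insertion radius. -/
def insert (K : Codes) (ra : ℕ) (x : Word) (D : BitTree) : Timed BitTree := do
  let cs ← closeFilters K ra x
  addToBuckets x cs D

/-- Remove `x`; `ra` is the insertion radius. -/
def remove (K : Codes) (ra : ℕ) (x : Word) (D : BitTree) : Timed BitTree := do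
  let cs ← closeFilters K ra x
  deleteFromBuckets x cs D

/-- Add to `S` the listed vectors that are within distance `rc` of `q`. -/
def addClose (rc : ℕ) (q : Word) : List Word → BitTree → Timed BitTree
  | [], S => pure S
  | x :: xs, S => do
      tick 1
      let d ← dist x q
      if d ≤ rc then do
        let S' ← BitTree.add x S
        addClose rc q xs S'
      else addClose rc q xs S

/-- Go through the buckets of the listed filter vectors and add to `S` all their vectors that are
within distance `rc` of `q`. -/
def scanBuckets (rc : ℕ) (q : Word) (D : BitTree) : List Word → BitTree → Timed BitTree
  | [], S => pure S
  | c :: cs, S => do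
      tick 1
      let B ← BitTree.find c D
      let xs ← BitTree.toList B
      let S' ← addClose rc q xs S
      scanBuckets rc q D cs S'

/-- Answer the query `q`: the set of the vectors at distance at most `rc` (target distance) from `q` in
the buckets whose filter vectors are at distance at most `rb` (query radius) from `q`. -/
def query (K : Codes) (rb rc : ℕ) (q : Word) (D : BitTree) : Timed BitTree := do
  let cs ← closeFilters K rb q
  scanBuckets rc q D cs BitTree.empty

/-- Insert all vectors of a list. -/
def insertList (K : Codes) (ra : ℕ) : List Word → BitTree → Timed BitTree
  | [], D => pure D
  | x :: xs, D => do
      tick 1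
      let D' ← insert K ra x D
      insertList K ra xs D'

/-- The number of bits of the short codes. -/
def codeBits (K : Codes) : ℕ := (K.map (fun p => p.1 * p.2.length)).sum

/-- Preprocess a list: write down the short codes, and insert all vectors of the list into an initially
empty data structure. -/
def preprocess (K : Codes) (ra : ℕ) (L : List Word) : Timed BitTree := do
  tick (codeBits K)
  insertList K ra L BitTree.empty

/-! ## Random filter vectors -/

/-- The shape of a product code in dimension `n`: the dimension is cut into `ℓ` blocks, the `i`-th of
length `len i`, and the `i`-th short code has `size i ≥ 1` codewords. -/
structure Shape (n : ℕ) where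
  ℓ : ℕ
  len : Fin ℓ → ℕ
  size : Fin ℓ → ℕ
  sum_len : ∑ i, len i = n
  size_pos : ∀ i, 0 < size i

namespace Shape

variable {n : ℕ} (P : Shape n)

/-- The possible values of the short codes. A uniformly distributed element of this finite type
consists of independent uniformly random codewords. -/
abbrev Code : Type := (i : Fin P.ℓ) → Fin (P.size i) → Fin (P.len i) → ZMod 2

/-- The number `|C|` of filter vectors (counted with multiplicity). -/
def numFilters : ℕ := ∏ i, P.size i

/-- The total number of codewords of the short codes. -/
def numCodewords : ℕ := ∑ i, P.size i

/-- The short codes as they are given to the routines. -/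
def toCodes {n : ℕ} {P : Shape n} (K : P.Code) : Codes :=
  List.ofFn fun i => (P.len i, List.ofFn fun a => List.ofFn (K i a))

end Shape

/-! ## Buckets, costs, and asymptotic comparison -/

/-- The unnormalised radius: an integer `d` satisfies `d ≤ radius δ n` iff `d ≤ δ n`. -/
noncomputable def radius (δ : ℝ) (n : ℕ) : ℕ := ⌊δ * n⌋₊

/-- The bucket of `c`: the set of the vectors of the list `L` at distance at most `α n` from `c`. -/
noncomputable def bucket (α : ℝ) {n N : ℕ} (L : Fin N → Fin n → ZMod 2) (c : Fin n → ZMod 2) :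
    Finset (Fin n → ZMod 2) :=
  (Finset.univ.image L).filter fun v => (hammingDist v c : ℝ) ≤ α * n

/-- The expected size of the bucket of `c`, for a list of `N` independent uniform vectors. -/
noncomputable def expBucket (α : ℝ) (N : ℕ) {n : ℕ} (c : Fin n → ZMod 2) : ℝ :=
  𝔼 L : Fin N → Fin n → ZMod 2, ((bucket α L c).card : ℝ)

/-- A list of vectors as it is given to the routines. -/
def toWords {n N : ℕ} (L : Fin N → Fin n → ZMod 2) : List Word :=
  List.ofFn fun k => List.ofFn (L k)

/-- Expected cost of inserting `x` when the data structure currently holds `D` (which may depend on the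
random filter vectors). -/
noncomputable def expInsert (α : ℝ) {n : ℕ} (P : Shape n) (x : Fin n → ZMod 2)
    (D : P.Code → BitTree) : ℝ :=
  𝔼 K : P.Code, ((insert (Shape.toCodes K) (radius α n) (List.ofFn x) (D K)).cost : ℝ)

/-- Expected cost of removing `x` when the data structure currently holds `D`. -/
noncomputable def expRemove (α : ℝ) {n : ℕ} (P : Shape n) (x : Fin n → ZMod 2)
    (D : P.Code → BitTree) : ℝ :=
  𝔼 K : P.Code, ((remove (Shape.toCodes K) (radius α n) (List.ofFn x) (D K)).cost : ℝ)

/-- Expected cost of preprocessing a list of `N` independent uniform vectors. -/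
noncomputable def expPreprocess (α : ℝ) {n : ℕ} (P : Shape n) (N : ℕ) : ℝ :=
  𝔼 ω : P.Code × (Fin N → Fin n → ZMod 2),
    ((preprocess (Shape.toCodes ω.1) (radius α n) (toWords ω.2)).cost : ℝ)

/-- Expected cost of answering the query `q` after a list of `N` independent uniform vectors has been
preprocessed (the cost of the preprocessing itself is not counted). -/
noncomputable def expQuery (α β γ : ℝ) {n : ℕ} (P : Shape n) (N : ℕ) (q : Fin n → ZMod 2) : ℝ :=
  𝔼 ω : P.Code × (Fin N → Fin n → ZMod 2),
    ((query (Shape.toCodes ω.1) (radius β n) (radius γ n) (List.ofFn q)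
      (preprocess (Shape.toCodes ω.1) (radius α n) (toWords ω.2)).val).cost : ℝ)

/-- The binary entropy function, in bits. -/
noncomputable def H (p : ℝ) : ℝ := -p * Real.logb 2 p - (1 - p) * Real.logb 2 (1 - p)

/-- `2 ^ ((H(δ) - 1) n)`. -/
noncomputable def rate (δ : ℝ) (n : ℕ) : ℝ := (2 : ℝ) ^ ((H δ - 1) * n)

/-- `f ≤ 2 ^ o(n) * g`. -/
def SubexpLE (f g : ℕ → ℝ) : Prop :=
  ∃ ε : ℕ → ℝ, ε =o[atTop] (fun n : ℕ => (n : ℝ)) ∧ ∀ᶠ n in atTop, f n ≤ (2 : ℝ) ^ ε n * g n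

/-- `f` and `g` are equal up to factors that are subexponential in `n`. -/
def SubexpEq (f g : ℕ → ℝ) : Prop := SubexpLE f g ∧ SubexpLE g f

end LSF

/-! For every outcome of the randomness the cost of a routine lies between a simple count and that
count times a polynomial in `n` and the number of short codewords, which is subexponential. For an
update the count is one plus the number of close filter vectors; preprocessing sums this over the
list; for a query it is one plus the sum of `1 + |B_c|` over the close filter vectors. Taking
expectations leaves only these counts to be evaluated.

The upper bounds rest on an output-sensitive decoder (`enumerate_cost_le`). A partial choice is kept
only if the exact minimum over the remaining blocks still permits a completion, so every recursive
call yields a vector to which its work can be charged. For queries one also needs that the subtree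
below a filter vector stores exactly its bucket (`find_preprocess_spec`) and can be listed in time
`O(n)` per vector, up to an additive constant (`toList_cost_le`).

The filter vectors share codewords and are thus dependent, but each of them is uniform
(`expect_sum_allWords`). By linearity the expected number within `δ n` of a point is exactly `|C|`
times the fraction of space covered by a ball, and that fraction is `2 ^ ((H δ - 1) n)` up to
subexponential factors (`ballFrac_subexpEq_rate`). A bucket is a set, so its expected size is the
ball volume times the probability that a given vector occurs in the list (`expBucket_eq`), which for
`|L| ≤ 2 ^ n` is `|L| / 2 ^ n` up to a factor `2`. This size does not depend on the centre, and `C`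
is independent of `L`; hence the expected query count factorises (`expect_sum_buckets`). Finally `1
+ F` and `max 1 F` agree up to a factor `2`, and the extra conditions remove the maxima. -/

namespace LSF

/-! ## Comparison up to subexponential factors -/

namespace SubexpLE

variable {f g h f₁ f₂ g₁ g₂ : ℕ → ℝ}

theorem of_le (hfg : ∀ n, f n ≤ g n) : SubexpLE f g :=
  ⟨fun _ => 0, isLittleO_zero _ _, .of_forall fun n => by simpa using hfg n⟩

theorem refl (f : ℕ → ℝ) : SubexpLE f f := of_le fun _ => le_rfl

theorem trans (h₁ : SubexpLE f g) (h₂ : SubexpLE g h) : SubexpLE f h := by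
  obtain ⟨ε, hε, h₁⟩ := h₁
  obtain ⟨δ, hδ, h₂⟩ := h₂
  refine ⟨fun n => ε n + δ n, hε.add hδ, ?_⟩
  filter_upwards [h₁, h₂] with n h₁ h₂
  rw [Real.rpow_add two_pos, mul_assoc]
  exact h₁.trans (by gcongr)

theorem mul (h₁ : SubexpLE f₁ g₁) (h₂ : SubexpLE f₂ g₂) (hf₂ : ∀ n, 0 ≤ f₂ n)
    (hg₁ : ∀ n, 0 ≤ g₁ n) : SubexpLE (fun n => f₁ n * f₂ n) (fun n => g₁ n * g₂ n) := by
  obtain ⟨ε, hε, h₁⟩ := h₁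
  obtain ⟨δ, hδ, h₂⟩ := h₂
  refine ⟨fun n => ε n + δ n, hε.add hδ, ?_⟩
  filter_upwards [h₁, h₂] with n h₁ h₂
  rw [Real.rpow_add two_pos, mul_mul_mul_comm]
  exact mul_le_mul h₁ h₂ (hf₂ n) (mul_nonneg (by positivity) (hg₁ n))

theorem const_mul {c : ℕ → ℝ} (hc : ∀ n, 0 ≤ c n) (h : SubexpLE f g) :
    SubexpLE (fun n => c n * f n) (fun n => c n * g n) := by
  obtain ⟨ε, hε, h⟩ := h
  refine ⟨ε, hε, ?_⟩
  filter_upwards [h] with n h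
  rw [mul_left_comm]
  exact mul_le_mul_of_nonneg_left h (hc n)

theorem max (h₁ : SubexpLE f₁ g₁) (h₂ : SubexpLE f₂ g₂) (hg₁ : ∀ n, 0 ≤ g₁ n)
    (hg₂ : ∀ n, 0 ≤ g₂ n) :
    SubexpLE (fun n => Max.max (f₁ n) (f₂ n)) (fun n => Max.max (g₁ n) (g₂ n)) := by
  obtain ⟨ε, hε, h₁⟩ := h₁
  obtain ⟨δ, hδ, h₂⟩ := h₂
  -- The exponents may be negative; the sum of absolute values dominates both.
  refine ⟨fun n => |ε n| + |δ n|, hε.abs_left.add hδ.abs_left, ?_⟩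
  filter_upwards [h₁, h₂] with n h₁ h₂
  refine max_le (h₁.trans ?_) (h₂.trans ?_)
  · gcongr
    · exact hg₁ n
    · norm_num
    · linarith [le_abs_self (ε n), abs_nonneg (δ n)]
    · exact le_max_left _ _
  · gcongr
    · exact hg₂ n
    · norm_num
    · linarith [le_abs_self (δ n), abs_nonneg (ε n)]
    · exact le_max_right _ _

theorem const (c : ℝ) : SubexpLE (fun _ => c) (fun _ => 1) := by
  refine ⟨fun _ => Real.logb 2 (|c| + 1), ?_, .of_forall fun n => ?_⟩
  · exact isLittleO_const_left.2 (.inr (by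
      simpa [Function.comp_def] using tendsto_natCast_atTop_atTop (R := ℝ)))
  · rw [Real.rpow_logb two_pos (by norm_num) (by positivity)]
    linarith [le_abs_self c]

theorem natCast_add_one : SubexpLE (fun n => (n : ℝ) + 1) (fun _ => 1) := by
  refine ⟨fun n => Real.logb 2 ((n : ℝ) + 1), ?_, .of_forall fun n => ?_⟩
  · have h₁ : (fun n : ℕ => Real.log ((n : ℝ) + 1)) =o[atTop] fun n : ℕ => ((n : ℝ) + 1) :=
      Real.isLittleO_log_id_atTop.comp_tendsto
        (tendsto_atTop_add_const_right _ 1 tendsto_natCast_atTop_atTop)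
    have h₂ : (fun n : ℕ => ((n : ℝ) + 1)) =O[atTop] fun n : ℕ => (n : ℝ) := by
      refine IsBigO.of_bound 2 ?_
      filter_upwards [eventually_ge_atTop 1] with n hn
      have : (1 : ℝ) ≤ n := by exact_mod_cast hn
      rw [Real.norm_of_nonneg (by positivity), Real.norm_of_nonneg (by positivity)]
      linarith
    simpa [Real.logb, div_eq_inv_mul] using (h₁.trans_isBigO h₂).const_mul_left (Real.log 2)⁻¹
  · rw [Real.rpow_logb two_pos (by norm_num) (by positivity)]
    simp

theorem mul_one (h₁ : SubexpLE f₁ (fun _ => 1)) (h₂ : SubexpLE f₂ (fun _ => 1))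
    (hf₂ : ∀ n, 0 ≤ f₂ n) : SubexpLE (fun n => f₁ n * f₂ n) (fun _ => 1) := by
  simpa using h₁.mul h₂ hf₂ fun _ => zero_le_one

theorem add_one (h₁ : SubexpLE f₁ (fun _ => 1)) (h₂ : SubexpLE f₂ (fun _ => 1)) :
    SubexpLE (fun n => f₁ n + f₂ n) (fun _ => 1) := by
  have h := h₁.max h₂ (fun _ => zero_le_one) fun _ => zero_le_one
  simp only [max_self] at h
  -- The functions may be negative; including `1` in the maximum makes the second factor of the
  -- product below nonnegative.
  have h' := h.max (refl fun _ => 1) (fun _ => zero_le_one) fun _ => zero_le_one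
  simp only [max_self] at h'
  refine .trans (of_le fun n => ?_) ((const 2).mul_one h' fun n => ?_)
  · have h1 := le_max_left (Max.max (f₁ n) (f₂ n)) 1
    have h2 := le_max_left (f₁ n) (f₂ n)
    have h3 := le_max_right (f₁ n) (f₂ n)
    linarith
  · exact zero_le_one.trans (le_max_right _ _)

/-- A subexponential factor can be dropped. -/
theorem of_le_mul {c : ℕ → ℝ} (hc : SubexpLE c (fun _ => 1)) (hg : ∀ n, 0 ≤ g n)
    (h : ∀ n, f n ≤ c n * g n) : SubexpLE f g :=
  (of_le h).trans (by simpa using hc.mul (refl g) hg fun _ => zero_le_one)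

end SubexpLE

namespace SubexpEq

variable {f g h f₁ f₂ g₁ g₂ : ℕ → ℝ}

theorem refl (f : ℕ → ℝ) : SubexpEq f f := ⟨.refl f, .refl f⟩

theorem trans (h₁ : SubexpEq f g) (h₂ : SubexpEq g h) : SubexpEq f h :=
  ⟨h₁.1.trans h₂.1, h₂.2.trans h₁.2⟩

theorem mul (h₁ : SubexpEq f₁ g₁) (h₂ : SubexpEq f₂ g₂) (hf₁ : ∀ n, 0 ≤ f₁ n)
    (hf₂ : ∀ n, 0 ≤ f₂ n) (hg₁ : ∀ n, 0 ≤ g₁ n) (hg₂ : ∀ n, 0 ≤ g₂ n) :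
    SubexpEq (fun n => f₁ n * f₂ n) (fun n => g₁ n * g₂ n) :=
  ⟨h₁.1.mul h₂.1 hf₂ hg₁, h₁.2.mul h₂.2 hg₂ hf₁⟩

theorem const_mul {c : ℕ → ℝ} (hc : ∀ n, 0 ≤ c n) (h : SubexpEq f g) :
    SubexpEq (fun n => c n * f n) (fun n => c n * g n) :=
  ⟨h.1.const_mul hc, h.2.const_mul hc⟩

theorem max (h₁ : SubexpEq f₁ g₁) (h₂ : SubexpEq f₂ g₂) (hf₁ : ∀ n, 0 ≤ f₁ n)
    (hf₂ : ∀ n, 0 ≤ f₂ n) (hg₁ : ∀ n, 0 ≤ g₁ n) (hg₂ : ∀ n, 0 ≤ g₂ n) :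
    SubexpEq (fun n => Max.max (f₁ n) (f₂ n)) (fun n => Max.max (g₁ n) (g₂ n)) :=
  ⟨h₁.1.max h₂.1 hg₁ hg₂, h₁.2.max h₂.2 hf₁ hf₂⟩

theorem one_max (h : SubexpLE (fun _ => 1) f) (hf : ∀ n, 0 ≤ f n) :
    SubexpEq (fun n => Max.max 1 (f n)) f := by
  refine ⟨?_, .of_le fun n => le_max_right _ _⟩
  simpa using h.max (.refl f) hf hf

end SubexpEq

/-! ## The volume of a Hamming ball -/

/-- The number of points of a Hamming ball of radius `r` in dimension `n`. -/
def ballVol (n r : ℕ) : ℕ := ∑ i ∈ Finset.range (r + 1), n.choose i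

theorem H_eq_binEntropy (p : ℝ) : H p = Real.binEntropy p / Real.log 2 := by
  simp only [H, Real.binEntropy, Real.logb, Real.log_inv]
  ring

theorem two_rpow_H_mul (p x : ℝ) : (2 : ℝ) ^ (H p * x) = Real.exp (Real.binEntropy p * x) := by
  rw [H_eq_binEntropy, Real.rpow_def_of_pos two_pos]
  congr 1
  have : Real.log 2 ≠ 0 := (Real.log_pos one_lt_two).ne'
  field_simp

theorem radius_le (δ : ℝ) (hδ₀ : 0 ≤ δ) (n : ℕ) : (radius δ n : ℝ) ≤ δ * n :=
  Nat.floor_le (by positivity)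

theorem radius_le_dim {δ : ℝ} (hδ₀ : 0 ≤ δ) (hδ₁ : δ ≤ 1 / 2) (n : ℕ) : radius δ n ≤ n := by
  have h : (radius δ n : ℝ) ≤ n := (radius_le δ hδ₀ n).trans
    (mul_le_of_le_one_left (Nat.cast_nonneg n) (by linarith))
  exact_mod_cast h

/-- Under independent Bernoulli(`δ`) coordinates each point of the ball around `0` has probability
at least `2 ^ (-H(δ) n)`, because `δ ≤ 1 - δ`; these probabilities add up to at most `1`. -/
theorem ballVol_le {δ : ℝ} (hδ₀ : 0 ≤ δ) (hδ₁ : δ ≤ 1 / 2) (n : ℕ) :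
    (ballVol n (radius δ n) : ℝ) ≤ (2 : ℝ) ^ (H δ * n) := by
  rcases hδ₀.eq_or_lt with rfl | hδ
  · simp [ballVol, radius, H]
  rw [two_rpow_H_mul]
  have hterm : ∀ i ∈ Finset.range (radius δ n + 1),
      Real.exp (-(Real.binEntropy δ * n)) ≤ δ ^ i * (1 - δ) ^ (n - i) := by
    intro i hi
    have hi' : i ≤ radius δ n := by simpa [Nat.lt_succ_iff] using hi
    have hin : i ≤ n := hi'.trans (radius_le_dim hδ₀ hδ₁ n)
    have hiδ : (i : ℝ) ≤ δ * n := le_trans (by exact_mod_cast hi') (radius_le δ hδ₀ n)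
    have hpow : δ ^ i * (1 - δ) ^ (n - i)
        = Real.exp (i * Real.log δ + (n - i : ℕ) * Real.log (1 - δ)) := by
      rw [Real.exp_add, Real.exp_nat_mul, Real.exp_nat_mul, Real.exp_log hδ,
        Real.exp_log (by linarith)]
    rw [hpow, Real.exp_le_exp, Nat.cast_sub hin]
    simp only [Real.binEntropy, Real.log_inv]
    have hlog : Real.log δ ≤ Real.log (1 - δ) := Real.log_le_log hδ (by linarith)
    -- The exponent is affine in `i` with slope `log δ - log (1 - δ) ≤ 0`, and at `i = δ n` it
    -- equals `-binEntropy δ * n`.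
    nlinarith [mul_nonneg (sub_nonneg.2 hiδ) (sub_nonneg.2 hlog)]
  have hsum : (ballVol n (radius δ n) : ℝ) * Real.exp (-(Real.binEntropy δ * n)) ≤ 1 := by
    calc (ballVol n (radius δ n) : ℝ) * Real.exp (-(Real.binEntropy δ * n))
        = ∑ i ∈ Finset.range (radius δ n + 1),
            Real.exp (-(Real.binEntropy δ * n)) * n.choose i := by
          rw [ballVol, Nat.cast_sum, Finset.sum_mul]
          exact Finset.sum_congr rfl fun _ _ => mul_comm _ _
      _ ≤ ∑ i ∈ Finset.range (radius δ n + 1), δ ^ i * (1 - δ) ^ (n - i) * n.choose i :=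
          Finset.sum_le_sum fun i hi => mul_le_mul_of_nonneg_right (hterm i hi) (Nat.cast_nonneg _)
      _ ≤ ∑ i ∈ Finset.range (n + 1), δ ^ i * (1 - δ) ^ (n - i) * n.choose i := by
          refine Finset.sum_le_sum_of_subset_of_nonneg ?_ fun i _ _ => ?_
          · exact Finset.range_subset_range.2 (Nat.succ_le_succ (radius_le_dim hδ₀ hδ₁ n))
          · have : 0 ≤ 1 - δ := by linarith
            positivity
      _ = 1 := by rw [← add_pow]; simp
  rw [Real.exp_neg, ← div_eq_mul_inv, div_le_one (Real.exp_pos _)] at hsum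
  exact hsum

/-- The sequence `k ^ i / i!` rises up to `i = k` and does not rise afterwards; denominators are
cleared. -/
theorem factorial_mul_pow_le (k i : ℕ) : k.factorial * k ^ i ≤ i.factorial * k ^ k := by
  rcases le_total k i with h | h
  · obtain ⟨j, rfl⟩ := Nat.exists_eq_add_of_le h
    calc k.factorial * k ^ (k + j) = k.factorial * k ^ j * k ^ k := by ring
      _ ≤ (k + j).factorial * k ^ k := by
        gcongr
        exact le_trans (by gcongr; omega) Nat.factorial_mul_pow_le_factorial
  · obtain ⟨j, rfl⟩ := Nat.exists_eq_add_of_le h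
    have hfac : (i + j).factorial = i.factorial * (i + j).descFactorial j := by
      rw [← Nat.factorial_mul_descFactorial (Nat.le_add_left j i), Nat.add_sub_cancel]
    calc (i + j).factorial * (i + j) ^ i ≤ i.factorial * (i + j) ^ j * (i + j) ^ i := by
          rw [hfac]
          gcongr
          exact Nat.descFactorial_le_pow _ _
      _ = i.factorial * (i + j) ^ (i + j) := by ring

/-- The `a`-th term of the binomial expansion of `(a + b) ^ (a + b)` is the largest one. -/
theorem pow_mul_choose_le {a b m : ℕ} (hm : m ≤ a + b) :
    a ^ m * b ^ (a + b - m) * (a + b).choose m ≤ (a + b).choose a * (a ^ a * b ^ b) := by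
  -- Multiplying by these four factorials turns both binomials into `(a + b)!` and leaves a product
  -- of two instances of `factorial_mul_pow_le`.
  have hpos : 0 < (m.factorial * (a + b - m).factorial) * (a.factorial * b.factorial) := by
    positivity
  refine Nat.le_of_mul_le_mul_left ?_ hpos
  have h₁ := Nat.choose_mul_factorial_mul_factorial hm
  have h₂ := Nat.choose_mul_factorial_mul_factorial (Nat.le_add_right a b)
  rw [Nat.add_sub_cancel_left] at h₂
  calc _ = ((a + b).choose m * m.factorial * (a + b - m).factorial) *
        ((a.factorial * a ^ m) * (b.factorial * b ^ (a + b - m))) := by ring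
    _ ≤ ((a + b).choose a * a.factorial * b.factorial) *
        ((m.factorial * a ^ a) * ((a + b - m).factorial * b ^ b)) := by
      rw [h₁, h₂]
      exact Nat.mul_le_mul_left _
        (Nat.mul_le_mul (factorial_mul_pow_le _ _) (factorial_mul_pow_le _ _))
    _ = _ := by ring

/-- The binomial expansion has `a + b + 1` terms, none above the `a`-th. -/
theorem pow_self_le_choose_mul (a b : ℕ) :
    (a + b) ^ (a + b) ≤ (a + b + 1) * ((a + b).choose a * (a ^ a * b ^ b)) := by
  conv_lhs => rw [add_pow]
  refine (Finset.sum_le_card_nsmul _ _ _ fun m hm => ?_).trans_eq (by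
    rw [Finset.card_range, smul_eq_mul])
  exact pow_mul_choose_le (Nat.lt_succ_iff.1 (Finset.mem_range.1 hm))

/-- This is `exp (n h(a/n)) = n ^ n / (a ^ a b ^ b)` with `n = a + b`, written without division; the
convention `0 ^ 0 = 1` covers the endpoints. -/
theorem exp_binEntropy_mul (a b : ℕ) (hab : 0 < a + b) :
    Real.exp (Real.binEntropy ((a : ℝ) / (a + b : ℕ)) * (a + b : ℕ)) * (a ^ a * b ^ b)
      = (a + b : ℕ) ^ (a + b) := by
  rcases Nat.eq_zero_or_pos a with rfl | ha
  · simp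
  rcases Nat.eq_zero_or_pos b with rfl | hb
  · have : (a : ℝ) ≠ 0 := by exact_mod_cast ha.ne'
    simp [div_self this]
  have ha' : (0 : ℝ) < a := by exact_mod_cast ha
  have hb' : (0 : ℝ) < b := by exact_mod_cast hb
  have hn' : (0 : ℝ) < (a + b : ℕ) := by exact_mod_cast hab
  have hsub : 1 - (a : ℝ) / (a + b : ℕ) = b / (a + b : ℕ) := by
    rw [eq_div_iff hn'.ne', sub_mul, div_mul_cancel₀ _ hn'.ne']
    push_cast
    ring
  have key : Real.binEntropy ((a : ℝ) / (a + b : ℕ)) * (a + b : ℕ)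
      = (a + b : ℕ) * Real.log (a + b : ℕ) - (a * Real.log a + b * Real.log b) := by
    rw [Real.binEntropy, hsub, Real.log_inv, Real.log_inv, Real.log_div ha'.ne' hn'.ne',
      Real.log_div hb'.ne' hn'.ne']
    have hn := hn'.ne'
    generalize Real.log _ = x
    field_simp
    push_cast
    ring
  rw [key, Real.exp_sub, Real.exp_add, Real.exp_nat_mul, Real.exp_nat_mul, Real.exp_nat_mul,
    Real.exp_log ha', Real.exp_log hb', Real.exp_log hn']
  field_simp

theorem two_rpow_H_le_ballVol {n k : ℕ} (hn : 0 < n) (hk : k ≤ n) :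
    (2 : ℝ) ^ (H ((k : ℝ) / n) * n) ≤ (n + 1) * ballVol n k := by
  obtain ⟨b, rfl⟩ := Nat.exists_eq_add_of_le hk
  rw [two_rpow_H_mul]
  have hpos : (0 : ℝ) < k ^ k * b ^ b := by
    have h₁ : 0 < k ^ k := Nat.pow_self_pos
    have h₂ : 0 < b ^ b := Nat.pow_self_pos
    exact_mod_cast Nat.mul_pos h₁ h₂
  refine le_of_mul_le_mul_right ?_ hpos
  rw [exp_binEntropy_mul k b hn]
  have h₁ : (k + b).choose k ≤ ballVol (k + b) k :=
    Finset.single_le_sum (f := fun i => (k + b).choose i) (fun _ _ => Nat.zero_le _)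
      (Finset.mem_range.2 k.lt_succ_self)
  have h₂ : (k + b) ^ (k + b) ≤ (k + b + 1) * ballVol (k + b) k * (k ^ k * b ^ b) := by
    refine (pow_self_le_choose_mul k b).trans ?_
    rw [← mul_assoc]
    gcongr
  exact_mod_cast h₂

theorem continuous_H : Continuous H := by
  have : H = fun p => Real.binEntropy p / Real.log 2 := funext H_eq_binEntropy
  rw [this]
  exact Real.binEntropy_continuous.div_const _

theorem tendsto_radius_div {δ : ℝ} (hδ₀ : 0 ≤ δ) :
    Tendsto (fun n : ℕ => (radius δ n : ℝ) / n) atTop (nhds δ) :=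
  (tendsto_nat_floor_mul_div_atTop (R := ℝ) hδ₀).comp tendsto_natCast_atTop_atTop

/-- The fraction of the space that a Hamming ball of radius `δ n` covers. -/
noncomputable def ballFrac (δ : ℝ) (n : ℕ) : ℝ := ballVol n (radius δ n) / 2 ^ n

theorem ballFrac_nonneg (δ : ℝ) (n : ℕ) : 0 ≤ ballFrac δ n := by
  unfold ballFrac
  positivity

theorem rate_nonneg (δ : ℝ) (n : ℕ) : 0 ≤ rate δ n := by
  unfold rate
  positivity

theorem rate_eq (δ : ℝ) (n : ℕ) : rate δ n = 2 ^ (H δ * n) / 2 ^ n := by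
  rw [rate, sub_mul, one_mul, Real.rpow_sub two_pos, Real.rpow_natCast]

theorem ballFrac_subexpEq_rate {δ : ℝ} (hδ₀ : 0 ≤ δ) (hδ₁ : δ ≤ 1 / 2) :
    SubexpEq (ballFrac δ) (rate δ) := by
  refine ⟨.of_le fun n => ?_, ?_⟩
  · rw [rate_eq, ballFrac]
    gcongr
    exact ballVol_le hδ₀ hδ₁ n
  refine SubexpLE.trans (g := fun n => ((n : ℝ) + 1) * ballFrac δ n) ?_
    (.of_le_mul .natCast_add_one (ballFrac_nonneg δ) fun n => le_rfl)
  -- The exponent pays for rounding `δ n` down to an integer; it is `o(n)` since `H` is continuous.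
  refine ⟨fun n => (H δ - H ((radius δ n : ℝ) / n)) * n, ?_, ?_⟩
  · have h : Tendsto (fun n : ℕ => H δ - H ((radius δ n : ℝ) / n)) atTop (nhds 0) := by
      simpa using (continuous_H.tendsto δ |>.comp (tendsto_radius_div hδ₀)).const_sub (H δ)
    simpa using ((isLittleO_one_iff ℝ).2 h).mul_isBigO (isBigO_refl (fun n : ℕ => (n : ℝ)) atTop)
  · filter_upwards [eventually_gt_atTop 0] with n hn
    have h := two_rpow_H_le_ballVol hn (radius_le_dim hδ₀ hδ₁ n)
    rw [rate_eq, ballFrac, ← mul_div_assoc, ← mul_div_assoc]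
    gcongr
    calc (2 : ℝ) ^ (H δ * n)
        = 2 ^ ((H δ - H ((radius δ n : ℝ) / n)) * n) * 2 ^ (H ((radius δ n : ℝ) / n) * n) := by
          rw [← Real.rpow_add two_pos]
          ring_nf
      _ ≤ _ := by gcongr

end LSF

/-! ### Values and costs of step-counted computations -/

namespace Timed

variable {A B : Type}

@[simp] theorem val_pure (a : A) : (pure a : Timed A).val = a := rfl
@[simp] theorem cost_pure (a : A) : (pure a : Timed A).cost = 0 := rfl
@[simp] theorem val_bind (m : Timed A) (f : A → Timed B) : (m >>= f).val = (f m.val).val := rfl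
@[simp] theorem cost_bind (m : Timed A) (f : A → Timed B) :
    (m >>= f).cost = m.cost + (f m.val).cost := rfl
@[simp] theorem cost_tick (k : ℕ) : (tick k).cost = k := rfl

end Timed

namespace LSF

/-! ## Finding the close filter vectors -/

theorem dist_cons (a b : ZMod 2) (v w : Word) :
    (dist (a :: v) (b :: w)).val = (dist v w).val + if a = b then 0 else 1 := by
  simp only [dist, Timed.val_bind]
  split <;> simp

theorem dist_cost_le (v w : Word) : (dist v w).cost ≤ v.length := by
  induction v generalizing w with
  | nil => simp [dist]
  | cons a v ih =>
    cases w with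
    | nil => simp [dist]
    | cons b w =>
      have := ih w
      simp only [dist, Timed.cost_bind, Timed.cost_tick, Timed.cost_pure, List.length_cons]
      omega

theorem dist_append (v v' w w' : Word) (h : v.length = w.length) :
    (dist (v ++ v') (w ++ w')).val = (dist v w).val + (dist v' w').val := by
  induction v generalizing w with
  | nil =>
    obtain rfl : w = [] := List.length_eq_zero_iff.1 h.symm
    simp [dist]
  | cons a v ih =>
    cases w with
    | nil => simp at h
    | cons b w =>
      simp only [List.cons_append, dist_cons, ih w (by simpa using h)]
      omega

/-- All concatenations of codewords, one from every short code. -/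
def allWords : Codes → List Word
  | [] => [[]]
  | (_, cs) :: K => cs.flatMap fun c => (allWords K).map fun w => c ++ w

/-- The short codes are nonempty and have the stated block lengths. -/
def ValidCodes (K : Codes) : Prop := ∀ p ∈ K, p.2 ≠ [] ∧ ∀ c ∈ p.2, c.length = p.1

/-- The sum of the block lengths. -/
def totalLength (K : Codes) : ℕ := (K.map Prod.fst).sum

/-- The total number of codewords of the short codes. -/
def totalSize (K : Codes) : ℕ := (K.map fun p => p.2.length).sum

theorem length_of_mem_allWords {K : Codes} (hK : ValidCodes K) {w : Word} (hw : w ∈ allWords K) :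
    w.length = totalLength K := by
  induction K generalizing w with
  | nil => simpa [allWords, totalLength] using hw
  | cons p K ih =>
    obtain ⟨m, cs⟩ := p
    simp only [allWords, List.mem_flatMap, List.mem_map] at hw
    obtain ⟨c, hc, v, hv, rfl⟩ := hw
    have h₁ := (hK (m, cs) (by simp)).2 c hc
    have h₂ := ih (fun p hp => hK p (by simp [hp])) hv
    simp [totalLength, h₁, h₂] at *

/-- Short codes are nonempty, so bounding the number of codewords also bounds the number of blocks.
-/
theorem length_le_totalSize {K : Codes} (hK : ValidCodes K) : K.length ≤ totalSize K := by
  induction K with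
  | nil => simp
  | cons p K ih =>
    have h₁ := List.length_pos_iff.2 (hK p (by simp)).1
    have h₂ := ih fun p hp => hK p (by simp [hp])
    simp only [totalSize, List.map_cons, List.sum_cons, List.length_cons] at *
    omega

theorem distRow_val (x : Word) (cs : List Word) :
    (distRow x cs).val = cs.map fun c => (c, (dist c x).val) := by
  induction cs with
  | nil => rfl
  | cons c cs ih => simp [distRow, ih]

theorem distRow_cost_le (x : Word) (cs : List Word) (m : ℕ) (h : ∀ c ∈ cs, c.length ≤ m) :
    (distRow x cs).cost ≤ cs.length * (m + 1) := by
  induction cs with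
  | nil => simp [distRow]
  | cons c cs ih =>
    have h₁ := ih fun c hc => h c (by simp [hc])
    have h₂ := (dist_cost_le c x).trans (h c (by simp))
    simp only [distRow, Timed.cost_bind, Timed.cost_tick, Timed.cost_pure, List.length_cons]
    linarith

theorem distTable_cost_le {K : Codes} (hK : ValidCodes K) (x : Word) {n : ℕ}
    (hn : totalLength K ≤ n) : (distTable K x).cost ≤ (K.length + totalSize K) * (n + 1) := by
  induction K generalizing x with
  | nil => simp [distTable]
  | cons p K ih =>
    obtain ⟨m, cs⟩ := p
    simp only [totalLength, List.map_cons, List.sum_cons] at hn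
    have h₁ := ih (fun p hp => hK p (by simp [hp])) (x.drop m) (by simp only [totalLength]; omega)
    have h₂ := distRow_cost_le (x.take m) cs n
      fun c hc => ((hK (m, cs) (by simp)).2 c hc).trans_le (by omega)
    simp only [distTable, Timed.cost_bind, Timed.cost_tick, Timed.cost_pure, List.length_cons,
      totalSize, List.map_cons, List.sum_cons] at *
    have : m ≤ n := by omega
    linarith

/-- All choices of one entry from every row, with their total distances. -/
def combos : List (List (Word × ℕ)) → List (Word × ℕ)
  | [] => [([], 0)]
  | row :: rows => row.flatMap fun p => (combos rows).map fun q => (p.1 ++ q.1, p.2 + q.2)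

theorem combos_distTable {K : Codes} (hK : ValidCodes K) (x : Word)
    (hx : x.length = totalLength K) :
    combos (distTable K x).val = (allWords K).map fun w => (w, (dist w x).val) := by
  induction K generalizing x with
  | nil =>
    obtain rfl : x = [] := by simpa [totalLength] using hx
    simp [distTable, combos, allWords, dist]
  | cons p K ih =>
    obtain ⟨m, cs⟩ := p
    simp only [totalLength, List.map_cons, List.sum_cons] at hx
    have h := ih (fun p hp => hK p (by simp [hp])) (x.drop m)
      (by simp only [List.length_drop, totalLength]; omega)
    simp only [distTable, Timed.val_bind, Timed.val_pure, combos, h, distRow_val, allWords,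
      List.flatMap_map, List.map_flatMap, List.map_map]
    refine List.flatMap_congr fun c hc => List.map_congr_left fun w _ => ?_
    have hc' := (hK (m, cs) (by simp)).2 c hc
    have hlen : c.length = (x.take m).length := by
      simp only [List.length_take]
      simp only at hc'
      omega
    simp only [Function.comp_apply, Prod.mk.injEq, true_and]
    conv_rhs => rw [← List.take_append_drop m x]
    exact (dist_append c w _ _ hlen).symm

theorem minRow_le {row : List (Word × ℕ)} {p : Word × ℕ} (hp : p ∈ row) :
    (minRow row).val ≤ p.2 := by
  induction row with
  | nil => simp at hp
  | cons a row ih =>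
    cases row with
    | nil =>
      obtain rfl : p = a := by simpa using hp
      rfl
    | cons b row =>
      simp only [minRow, Timed.val_bind, Timed.val_pure]
      rcases List.mem_cons.1 hp with rfl | hp
      · exact min_le_left _ _
      · exact (min_le_right _ _).trans (ih hp)

theorem exists_mem_minRow {row : List (Word × ℕ)} (h : row ≠ []) :
    ∃ p ∈ row, p.2 = (minRow row).val := by
  induction row with
  | nil => exact absurd rfl h
  | cons a row ih =>
    cases row with
    | nil => exact ⟨a, by simp, rfl⟩
    | cons b row =>
      simp only [minRow, Timed.val_bind, Timed.val_pure]
      rcases min_choice a.2 (minRow (b :: row)).val with h' | h'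
      · exact ⟨a, by simp, h'.symm⟩
      · obtain ⟨p, hp, hp'⟩ := ih (by simp)
        exact ⟨p, List.mem_cons_of_mem _ hp, hp'.trans h'.symm⟩

theorem minRow_cost (row : List (Word × ℕ)) : (minRow row).cost = row.length := by
  induction row with
  | nil => rfl
  | cons a row ih =>
    cases row with
    | nil => rfl
    | cons b row =>
      simp only [minRow, Timed.cost_bind, Timed.cost_tick, Timed.cost_pure, ih, List.length_cons]
      omega

theorem minTotal_le {rows : List (List (Word × ℕ))} {q : Word × ℕ} (hq : q ∈ combos rows) :
    (minTotal rows).val ≤ q.2 := by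
  induction rows generalizing q with
  | nil => simp [minTotal]
  | cons row rows ih =>
    simp only [combos, List.mem_flatMap, List.mem_map] at hq
    obtain ⟨p, hp, q, hq, rfl⟩ := hq
    exact Nat.add_le_add (minRow_le hp) (ih hq)

/-- The pruning bound is attained. This is what guarantees that a surviving partial choice has an
admissible completion. -/
theorem exists_mem_minTotal {rows : List (List (Word × ℕ))} (h : ∀ row ∈ rows, row ≠ []) :
    ∃ q ∈ combos rows, q.2 = (minTotal rows).val := by
  induction rows with
  | nil => exact ⟨([], 0), by simp [combos], rfl⟩
  | cons row rows ih =>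
    obtain ⟨p, hp, hp'⟩ := exists_mem_minRow (h row (by simp))
    obtain ⟨q, hq, hq'⟩ := ih fun row hrow => h row (by simp [hrow])
    refine ⟨(p.1 ++ q.1, p.2 + q.2), ?_, ?_⟩
    · simp only [combos, List.mem_flatMap, List.mem_map]
      exact ⟨p, hp, q, hq, rfl⟩
    · simp [minTotal, hp', hq']

theorem minTotal_cost (rows : List (List (Word × ℕ))) :
    (minTotal rows).cost = rows.length + (rows.map List.length).sum := by
  induction rows with
  | nil => rfl
  | cons row rows ih =>
    simp only [minTotal, Timed.cost_bind, Timed.cost_tick, Timed.cost_pure, ih, minRow_cost,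
      List.length_cons, List.map_cons, List.sum_cons]
    omega

theorem collect_val (f : Word × ℕ → Timed (List Word)) (row : List (Word × ℕ)) :
    (collect f row).val = row.flatMap fun p => (f p).val := by
  induction row with
  | nil => rfl
  | cons p row ih => simp [collect, ih]

/-- The hypothesis has no additive term: an entry without output must be free, as pruned entries
are. Only the walk along the row is not charged to outputs. -/
theorem collect_cost_le (f : Word × ℕ → Timed (List Word)) (row : List (Word × ℕ)) (F : ℕ)
    (h : ∀ p ∈ row, (f p).cost ≤ F * (f p).val.length) :
    (collect f row).cost ≤ row.length + (F + 1) * (collect f row).val.length := by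
  induction row with
  | nil => simp [collect]
  | cons p row ih =>
    have h₁ := ih fun p hp => h p (by simp [hp])
    have h₂ := h p (by simp)
    simp only [collect, Timed.cost_bind, Timed.cost_tick, Timed.cost_pure, Timed.val_bind,
      Timed.val_pure, List.length_cons, List.length_append] at *
    linarith

theorem enumerate_val (rows : List (List (Word × ℕ))) (r : ℕ) :
    (enumerate rows r).val = ((combos rows).filter fun q => q.2 ≤ r).map Prod.fst := by
  induction rows generalizing r with
  | nil => simp [enumerate, combos]
  | cons row rows ih =>
    simp only [enumerate, Timed.val_bind, collect_val, combos, List.filter_flatMap,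
      List.map_flatMap]
    refine List.flatMap_congr fun p _ => ?_
    split
    · rename_i h
      simp only [Timed.val_bind, Timed.val_pure, ih, List.filter_map, List.map_map,
        Function.comp_def]
      congr 1
      refine List.filter_congr fun q _ => ?_
      simp only [decide_eq_decide]
      omega
    · rename_i h
      -- Pruning loses nothing: `minTotal_le` puts every completion of a discarded entry beyond `r`.
      rw [eq_comm, Timed.val_pure, List.map_eq_nil_iff, List.filter_eq_nil_iff]
      intro q hq
      obtain ⟨q', hq', rfl⟩ := List.mem_map.1 hq
      have := minTotal_le hq'
      simp only [decide_eq_true_eq]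
      omega

theorem enumerate_val_pos {rows : List (List (Word × ℕ))} (h : ∀ row ∈ rows, row ≠ []) {r : ℕ}
    (hr : (minTotal rows).val ≤ r) : 0 < (enumerate rows r).val.length := by
  obtain ⟨q, hq, hq'⟩ := exists_mem_minTotal h
  rw [enumerate_val, List.length_map]
  exact List.length_pos_of_mem (List.mem_filter.2 ⟨hq, by simpa [hq'] using hr⟩)

/-- Each output pays `m + 2 + T` per level: `m + 1` for prefixing a codeword, `1` for concatenating,
and `T` for computing the remaining minimum and walking along the row. -/
theorem enumerate_cost_le {rows : List (List (Word × ℕ))} (h : ∀ row ∈ rows, row ≠ []) {m T : ℕ}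
    (hm : ∀ row ∈ rows, ∀ p ∈ row, p.1.length ≤ m) (hT : (minTotal rows).cost ≤ T) {r : ℕ}
    (hr : (minTotal rows).val ≤ r) :
    (enumerate rows r).cost ≤ (rows.length * (m + 2 + T) + 1) * (enumerate rows r).val.length := by
  induction rows generalizing r with
  | nil => simp [enumerate]
  | cons row rows ih =>
    have hpos := enumerate_val_pos h hr
    rw [minTotal_cost, List.length_cons, List.map_cons, List.sum_cons] at hT
    have hT' : (minTotal rows).cost + row.length ≤ T := by rw [minTotal_cost]; omega
    simp only [enumerate, Timed.cost_bind, Timed.val_bind, List.length_cons] at hpos ⊢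
    have hc := collect_cost_le (fun p => if p.2 + (minTotal rows).val ≤ r then do
          let ws ← enumerate rows (r - p.2)
          tick (ws.length * (p.1.length + 1))
          pure (ws.map (fun w => p.1 ++ w))
        else pure []) row (rows.length * (m + 2 + T) + 1 + (m + 1)) (fun p hp => by
      split
      · rename_i hpr
        have h₁ := ih (fun row hrow => h row (by simp [hrow]))
          (fun row hrow => hm row (by simp [hrow])) (by omega) (r := r - p.2) (by omega)
        have h₂ : p.1.length + 1 ≤ m + 1 := Nat.succ_le_succ (hm row (by simp) p hp)
        simp only [Timed.cost_bind, Timed.val_bind, Timed.cost_tick, Timed.cost_pure,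
          Timed.val_pure, List.length_map, add_zero]
        rw [add_mul, mul_comm _ (p.1.length + 1)]
        exact Nat.add_le_add h₁ (Nat.mul_le_mul_right _ h₂)
      · simp)
    generalize (collect _ row).val.length = z at *
    generalize (collect _ row).cost = y at *
    -- The overhead of the level is incurred even once, so charging it to outputs requires at least
    -- one of them.
    have : T ≤ T * z := Nat.le_mul_of_pos_right _ hpos
    nlinarith

/-- The initial comparison with the minimum only skips runs that would return nothing. -/
theorem closeFilters_val {K : Codes} (hK : ValidCodes K) (r : ℕ) (x : Word)
    (hx : x.length = totalLength K) :
    (closeFilters K r x).val = (allWords K).filter fun w => (dist w x).val ≤ r := by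
  have h : (enumerate (distTable K x).val r).val
      = (allWords K).filter fun w => (dist w x).val ≤ r := by
    rw [enumerate_val, combos_distTable hK x hx, List.filter_map, List.map_map]
    simp [Function.comp_def]
  simp only [closeFilters, Timed.val_bind]
  split
  · exact h
  · rename_i hr
    rw [← h, eq_comm, Timed.val_pure, enumerate_val, List.map_eq_nil_iff, List.filter_eq_nil_iff]
    intro q hq
    have := minTotal_le hq
    simp only [decide_eq_true_eq]
    omega

theorem distTable_rows_length (K : Codes) (x : Word) :
    (distTable K x).val.map List.length = K.map fun p => p.2.length := by
  induction K generalizing x with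
  | nil => rfl
  | cons p K ih =>
    obtain ⟨m, cs⟩ := p
    simp [distTable, ih, distRow_val]

theorem mem_distTable {K : Codes} {x : Word} {row : List (Word × ℕ)}
    (h : row ∈ (distTable K x).val) : ∃ p ∈ K, row.map Prod.fst = p.2 := by
  induction K generalizing x with
  | nil => simp [distTable] at h
  | cons p K ih =>
    obtain ⟨m, cs⟩ := p
    simp only [distTable, Timed.val_bind, Timed.val_pure, List.mem_cons, distRow_val] at h
    rcases h with rfl | h
    · exact ⟨(m, cs), by simp, by simp [Function.comp_def]⟩
    · obtain ⟨p, hp, hp'⟩ := ih h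
      exact ⟨p, by simp [hp], hp'⟩

theorem le_totalLength {K : Codes} {p : ℕ × List Word} (hp : p ∈ K) : p.1 ≤ totalLength K :=
  List.single_le_sum (fun _ _ => Nat.zero_le _) _ (List.mem_map_of_mem hp)

/-- A bound for the work of `closeFilters` per vector found. -/
def decodingFactor (n S : ℕ) : ℕ := 3 * (n + 2) * (S + 1) ^ 2

/-- The summand `1` pays for the distance table and the minimum when no filter vector is close.
`decodingFactor` dominates both this fixed cost and the cost per output. -/
theorem closeFilters_cost_le {K : Codes} (hK : ValidCodes K) (r : ℕ) (x : Word) {n S : ℕ}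
    (hn : totalLength K = n) (hS : totalSize K = S) :
    (closeFilters K r x).cost ≤ decodingFactor n S * (1 + (closeFilters K r x).val.length) := by
  have hℓ : K.length ≤ S := hS ▸ length_le_totalSize hK
  have h₁ : (distTable K x).cost ≤ (K.length + S) * (n + 1) := hS ▸ distTable_cost_le hK x hn.le
  have hlen : (distTable K x).val.length = K.length := by
    simpa using congrArg List.length (distTable_rows_length K x)
  have h₂ : (minTotal (distTable K x).val).cost = K.length + S := by
    rw [minTotal_cost, distTable_rows_length, hlen, ← hS, totalSize]
  simp only [closeFilters, Timed.cost_bind, Timed.cost_tick, Timed.val_bind]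
  split
  · rename_i hr
    have h₃ := enumerate_cost_le (rows := (distTable K x).val) (m := n) (T := K.length + S)
      (fun row hrow => by
        obtain ⟨p, hp, hp'⟩ := mem_distTable hrow
        rintro rfl
        exact (hK p hp).1 hp'.symm)
      (fun row hrow q hq => by
        obtain ⟨p, hp, hp'⟩ := mem_distTable hrow
        rw [(hK p hp).2 q.1 (hp' ▸ List.mem_map_of_mem hq), ← hn]
        exact le_totalLength hp) h₂.le hr
    rw [hlen] at h₃
    have h₄ : K.length * (n + 2 + (K.length + S)) + 1 ≤ S * (n + 2 + (S + S)) + 1 := by gcongr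
    have h₅ : (K.length + S) * (n + 1) ≤ (S + S) * (n + 1) := by gcongr
    generalize (enumerate _ r).val.length = z at *
    generalize (enumerate _ r).cost = y at *
    have h₆ : y ≤ (S * (n + 2 + (S + S)) + 1) * z := h₃.trans (by gcongr)
    have h₇ : S * (n + 2 + (S + S)) + 1 ≤ decodingFactor n S := by
      unfold decodingFactor
      nlinarith [Nat.zero_le (n * S), Nat.zero_le (n * S ^ 2)]
    have h₈ : 1 + (S + S) * (n + 1) + (S + S) ≤ decodingFactor n S := by
      unfold decodingFactor
      nlinarith [Nat.zero_le (n * S), Nat.zero_le (n * S ^ 2)]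
    have h₉ := Nat.mul_le_mul_right z h₇
    rw [mul_add, mul_one]
    omega
  · have h₅ : (K.length + S) * (n + 1) ≤ (S + S) * (n + 1) := by gcongr
    have h₈ : 1 + (S + S) * (n + 1) + (S + S) ≤ decodingFactor n S := by
      unfold decodingFactor
      nlinarith [Nat.zero_le (n * S), Nat.zero_le (n * S ^ 2)]
    simp only [Timed.val_pure, Timed.cost_pure, List.length_nil]
    omega

theorem one_le_closeFilters_cost (K : Codes) (r : ℕ) (x : Word) :
    1 ≤ (closeFilters K r x).cost := by
  simp only [closeFilters, Timed.cost_bind, Timed.cost_tick]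
  omega

/-! ## Updates -/

namespace BitTree

theorem add_cost (w : Word) (t : BitTree) : (add w t).cost = w.length + 1 := by
  induction w generalizing t with
  | nil => rfl
  | cons b w ih =>
    simp only [add, Timed.cost_bind, Timed.cost_tick, List.length_cons]
    split <;> simp only [Timed.cost_bind, Timed.cost_pure, ih] <;> omega

theorem delete_cost_le (w : Word) (t : BitTree) : (delete w t).cost ≤ w.length + 1 := by
  induction w generalizing t with
  | nil => cases t <;> simp [delete]
  | cons b w ih =>
    cases t with
    | empty => simp [delete]
    | leaf =>
      have h₁ := ih leaf.left
      have h₂ := ih leaf.right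
      simp only [delete, Timed.cost_bind, Timed.cost_tick, List.length_cons]
      split <;> simp only [Timed.cost_bind, Timed.cost_pure] <;> omega
    | node l r =>
      have h₁ := ih (node l r).left
      have h₂ := ih (node l r).right
      simp only [delete, Timed.cost_bind, Timed.cost_tick, List.length_cons]
      split <;> simp only [Timed.cost_bind, Timed.cost_pure] <;> omega

theorem find_cost (w : Word) (t : BitTree) : (find w t).cost = w.length + 1 := by
  induction w generalizing t with
  | nil => rfl
  | cons b w ih =>
    simp only [find, Timed.cost_bind, Timed.cost_tick, List.length_cons]
    split <;> simp only [ih] <;> omega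

end BitTree

theorem length_le_addToBuckets_cost (x : Word) (cs : List Word) (D : BitTree) :
    cs.length ≤ (addToBuckets x cs D).cost := by
  induction cs generalizing D with
  | nil => simp
  | cons c cs ih =>
    have := ih (BitTree.add (c ++ x) D).val
    simp only [addToBuckets, Timed.cost_bind, Timed.cost_tick, List.length_cons]
    omega

theorem length_le_deleteFromBuckets_cost (x : Word) (cs : List Word) (D : BitTree) :
    cs.length ≤ (deleteFromBuckets x cs D).cost := by
  induction cs generalizing D with
  | nil => simp
  | cons c cs ih =>
    have := ih (BitTree.delete (c ++ x) D).val
    simp only [deleteFromBuckets, Timed.cost_bind, Timed.cost_tick, List.length_cons]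
    omega

theorem addToBuckets_cost_le {n : ℕ} {x : Word} (hx : x.length = n) {cs : List Word}
    (hcs : ∀ c ∈ cs, c.length = n) (D : BitTree) :
    (addToBuckets x cs D).cost ≤ (3 * n + 2) * cs.length := by
  induction cs generalizing D with
  | nil => simp [addToBuckets]
  | cons c cs ih =>
    have h₁ := ih (fun c hc => hcs c (by simp [hc])) (BitTree.add (c ++ x) D).val
    have h₂ := hcs c (by simp)
    simp only [addToBuckets, Timed.cost_bind, Timed.cost_tick, List.length_cons, BitTree.add_cost,
      List.length_append, hx, h₂, mul_add]
    omega

theorem deleteFromBuckets_cost_le {n : ℕ} {x : Word} (hx : x.length = n) {cs : List Word}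
    (hcs : ∀ c ∈ cs, c.length = n) (D : BitTree) :
    (deleteFromBuckets x cs D).cost ≤ (3 * n + 2) * cs.length := by
  induction cs generalizing D with
  | nil => simp [deleteFromBuckets]
  | cons c cs ih =>
    have h₁ := ih (fun c hc => hcs c (by simp [hc])) (BitTree.delete (c ++ x) D).val
    have h₂ := hcs c (by simp)
    have h₃ := BitTree.delete_cost_le (c ++ x) D
    simp only [deleteFromBuckets, Timed.cost_bind, Timed.cost_tick, List.length_cons,
      List.length_append, hx, h₂, mul_add] at *
    omega

theorem length_of_mem_closeFilters {K : Codes} (hK : ValidCodes K) {r : ℕ} {x : Word}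
    (hx : x.length = totalLength K) {c : Word} (hc : c ∈ (closeFilters K r x).val) :
    c.length = totalLength K := by
  rw [closeFilters_val hK r x hx] at hc
  exact length_of_mem_allWords hK (List.mem_of_mem_filter hc)

/-- A bound for the work of an update per filter vector found. -/
def updateFactor (n S : ℕ) : ℕ := decodingFactor n S + (3 * n + 2)

section

variable {K : Codes} (hK : ValidCodes K) {r n S : ℕ} {x : Word} (hn : totalLength K = n)
  (hS : totalSize K = S) (hx : x.length = n) (D : BitTree)
include hK hn hS hx

theorem insert_cost_le :
    (insert K r x D).cost ≤ updateFactor n S * (1 + (closeFilters K r x).val.length) := by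
  have h₁ := closeFilters_cost_le hK r x hn hS
  have h₂ := addToBuckets_cost_le hx
    (fun c hc => (length_of_mem_closeFilters hK (r := r) (hx.trans hn.symm) hc).trans hn) D
  simp only [insert, Timed.cost_bind, updateFactor, add_mul, mul_add] at *
  omega

theorem remove_cost_le :
    (remove K r x D).cost ≤ updateFactor n S * (1 + (closeFilters K r x).val.length) := by
  have h₁ := closeFilters_cost_le hK r x hn hS
  have h₂ := deleteFromBuckets_cost_le hx
    (fun c hc => (length_of_mem_closeFilters hK (r := r) (hx.trans hn.symm) hc).trans hn) D
  simp only [remove, Timed.cost_bind, updateFactor, add_mul, mul_add] at *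
  omega

end

theorem le_insert_cost (K : Codes) (r : ℕ) (x : Word) (D : BitTree) :
    1 + (closeFilters K r x).val.length ≤ (insert K r x D).cost :=
  Nat.add_le_add (one_le_closeFilters_cost K r x) (length_le_addToBuckets_cost x _ D)

theorem le_remove_cost (K : Codes) (r : ℕ) (x : Word) (D : BitTree) :
    1 + (closeFilters K r x).val.length ≤ (remove K r x D).cost :=
  Nat.add_le_add (one_le_closeFilters_cost K r x) (length_le_deleteFromBuckets_cost x _ D)

theorem le_insertList_cost (K : Codes) (r : ℕ) (L : List Word) (D : BitTree) :
    (L.map fun x => 1 + (closeFilters K r x).val.length).sum ≤ (insertList K r L D).cost := by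
  induction L generalizing D with
  | nil => simp
  | cons x L ih =>
    have h₁ := ih (insert K r x D).val
    have h₂ := le_insert_cost K r x D
    simp only [insertList, Timed.cost_bind, Timed.cost_tick, List.map_cons, List.sum_cons]
    omega

theorem insertList_cost_le {K : Codes} (hK : ValidCodes K) (r : ℕ) {n S : ℕ}
    (hn : totalLength K = n) (hS : totalSize K = S) {L : List Word} (hL : ∀ x ∈ L, x.length = n)
    (D : BitTree) :
    (insertList K r L D).cost ≤
      (updateFactor n S + 1) * (L.map fun x => 1 + (closeFilters K r x).val.length).sum := by
  induction L generalizing D with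
  | nil => simp [insertList]
  | cons x L ih =>
    have h₁ := ih (fun x hx => hL x (by simp [hx])) (insert K r x D).val
    have h₂ := insert_cost_le hK (r := r) hn hS (hL x (by simp)) D
    simp only [insertList, Timed.cost_bind, Timed.cost_tick, List.map_cons, List.sum_cons,
      add_mul, mul_add] at *
    omega

theorem codeBits_le (K : Codes) : codeBits K ≤ totalLength K * totalSize K := by
  rw [totalSize, ← List.sum_map_mul_left]
  exact List.sum_le_sum fun p hp => Nat.mul_le_mul_right _ (le_totalLength hp)

/-! ## The contents of the data structure -/

namespace BitTree

/-- The stored strings. -/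
def strings (t : BitTree) : List Word := t.toList.val

@[simp] theorem strings_empty : strings empty = [] := rfl
@[simp] theorem strings_leaf : strings leaf = [[]] := rfl
@[simp] theorem strings_node (l r : BitTree) : strings (node l r) =
    (strings l).map (fun w => 0 :: w) ++ (strings r).map (fun w => 1 :: w) := rfl

/-- All stored strings have length `d`, and no branch is kept on which nothing is stored. -/
inductive Reduced : ℕ → BitTree → Prop
  | empty (d : ℕ) : Reduced d empty
  | leaf : Reduced 0 leaf
  | node {d : ℕ} {l r : BitTree} (hl : Reduced d l) (hr : Reduced d r)
      (h : (node l r).strings ≠ []) : Reduced (d + 1) (node l r)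

namespace Reduced

theorem left {d : ℕ} {t : BitTree} (h : Reduced (d + 1) t) : Reduced d t.left := by
  cases h with
  | empty => exact .empty _
  | node hl _ _ => exact hl

theorem right {d : ℕ} {t : BitTree} (h : Reduced (d + 1) t) : Reduced d t.right := by
  cases h with
  | empty => exact .empty _
  | node _ hr _ => exact hr

theorem length_eq {d : ℕ} {t : BitTree} (h : Reduced d t) {v : Word} (hv : v ∈ t.strings) :
    v.length = d := by
  induction h generalizing v with
  | empty => simp at hv
  | leaf => simpa using hv
  | node _ _ _ ihl ihr =>
    simp only [strings_node, List.mem_append, List.mem_map] at hv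
    rcases hv with ⟨w, hw, rfl⟩ | ⟨w, hw, rfl⟩
    · simp [ihl hw]
    · simp [ihr hw]

end Reduced

theorem zmod_two_eq_one {b : ZMod 2} (hb : b ≠ 0) : b = 1 := by
  revert b
  decide

theorem cons_mem_strings {d : ℕ} {t : BitTree} (h : Reduced (d + 1) t) (b : ZMod 2) (v : Word) :
    b :: v ∈ t.strings ↔ v ∈ (if b = 0 then t.left else t.right).strings := by
  cases h with
  | empty => simp [left, right]
  | @node _ l r =>
    by_cases hb : b = 0
    · subst hb
      simp [left]
    · obtain rfl := zmod_two_eq_one hb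
      simp [right]

/-- Strings from the two subtrees differ in their first bit. Hence the length of the listing is the
size of the stored set. -/
theorem nodup_strings (t : BitTree) : t.strings.Nodup := by
  induction t with
  | empty => simp
  | leaf => simp
  | node l r ihl ihr =>
    rw [strings_node, List.nodup_append]
    refine ⟨ihl.map fun _ _ h => (List.cons.inj h).2, ihr.map fun _ _ h => (List.cons.inj h).2, ?_⟩
    rintro _ hv _ hw rfl
    obtain ⟨v, _, rfl⟩ := List.mem_map.1 hv
    obtain ⟨w, _, hw⟩ := List.mem_map.1 hw
    exact absurd (List.cons.inj hw).1 (by decide)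

/-- The depth matters: at the end of the word the tree is overwritten by `leaf`, which loses nothing
only because strings stored at depth `0` are empty. -/
theorem add_spec {d : ℕ} {t : BitTree} (h : Reduced d t) {w : Word} (hw : w.length = d) :
    Reduced d (add w t).val ∧ ∀ v, v ∈ (add w t).val.strings ↔ v = w ∨ v ∈ t.strings := by
  induction w generalizing d t with
  | nil =>
    subst hw
    refine ⟨.leaf, fun v => ?_⟩
    have : ∀ v ∈ t.strings, v = [] := fun v hv => List.length_eq_zero_iff.1 (h.length_eq hv)
    simp only [add, Timed.val_bind, Timed.val_pure, strings_leaf, List.mem_singleton]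
    exact ⟨.inl, fun hv => hv.elim id (this v)⟩
  | cons b w ih =>
    obtain ⟨d, rfl⟩ : ∃ d', d = d' + 1 := ⟨w.length, hw.symm⟩
    have hw : w.length = d := by simpa using hw
    obtain ⟨hl₁, hl₂⟩ := ih h.left hw
    obtain ⟨hr₁, hr₂⟩ := ih h.right hw
    -- The length condition excludes the empty string, so membership need only be compared for
    -- strings with a first bit.
    have hmem : ∀ l' r' : BitTree, Reduced (d + 1) (node l' r') →
        (∀ a v, v ∈ (if a = 0 then l' else r').strings ↔
          (a :: v = b :: w ∨ v ∈ (if a = 0 then t.left else t.right).strings)) →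
        ∀ v, v ∈ (node l' r').strings ↔ v = b :: w ∨ v ∈ t.strings := by
      intro l' r' hred hstep v
      rcases v with _ | ⟨a, v⟩
      · constructor
        · intro hv
          exact absurd (hred.length_eq hv) (by simp)
        · rintro (hv | hv)
          · exact absurd hv (by simp)
          · exact absurd (h.length_eq hv) (by simp)
      · rw [cons_mem_strings hred, cons_mem_strings h]
        exact hstep a v
    simp only [add, Timed.val_bind]
    by_cases hb : b = 0
    · subst hb
      simp only [if_true, Timed.val_bind, Timed.val_pure]
      have hred : Reduced (d + 1) (node (add w t.left).val t.right) := by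
        refine .node hl₁ h.right (List.ne_nil_of_mem (a := 0 :: w) ?_)
        simp [hl₂]
      refine ⟨hred, hmem _ _ hred fun a v => ?_⟩
      by_cases ha : a = 0
      · simp [ha, hl₂]
      · simp [ha]
    · simp only [if_neg hb, Timed.val_bind, Timed.val_pure]
      obtain rfl := zmod_two_eq_one hb
      have hred : Reduced (d + 1) (node t.left (add w t.right).val) := by
        refine .node h.left hr₁ (List.ne_nil_of_mem (a := 1 :: w) ?_)
        simp [hr₂]
      refine ⟨hred, hmem _ _ hred fun a v => ?_⟩
      by_cases ha : a = 0
      · subst ha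
        simp
      · obtain rfl := zmod_two_eq_one ha
        simp [hr₂]

theorem find_spec {d : ℕ} {w : Word} {t : BitTree} (h : Reduced (w.length + d) t) :
    Reduced d (find w t).val ∧ ∀ v, v ∈ (find w t).val.strings ↔ w ++ v ∈ t.strings := by
  induction w generalizing t with
  | nil => simpa [find] using h
  | cons b w ih =>
    rw [List.length_cons, Nat.add_right_comm] at h
    have h' : (find (b :: w) t).val = (find w (if b = 0 then t.left else t.right)).val := by
      simp only [find, Timed.val_bind]
      split <;> rfl
    have hred : Reduced (w.length + d) (if b = 0 then t.left else t.right) := by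
      split
      · exact h.left
      · exact h.right
    rw [h']
    exact ⟨(ih hred).1, fun v => by rw [(ih hred).2, List.cons_append, cons_mem_strings h]⟩

/-- A node of a reduced tree has a stored string below it. Of the `3` steps per string and level,
one copies a bit; the other two cover the node itself and the extra constant from having two
subtrees. -/
theorem toList_cost_le {d : ℕ} {t : BitTree} (h : Reduced d t) :
    t.toList.cost ≤ 1 + 3 * d * t.strings.length := by
  induction h with
  | empty => simp [toList]
  | leaf => simp [toList]
  | @node d l r _ _ h ihl ihr =>
    have hpos := List.length_pos_iff.2 h
    simp only [toList, Timed.cost_bind, Timed.cost_tick, Timed.cost_pure, strings_node,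
      List.length_append, List.length_map] at *
    simp only [strings] at *
    generalize l.toList.val.length = a at *
    generalize r.toList.val.length = b at *
    nlinarith

end BitTree

open BitTree (Reduced strings)

theorem addToBuckets_spec {n : ℕ} {x : Word} (hx : x.length = n) {cs : List Word}
    (hcs : ∀ c ∈ cs, c.length = n) {D : BitTree} (hD : Reduced (n + n) D) :
    Reduced (n + n) (addToBuckets x cs D).val ∧
      ∀ v, v ∈ (addToBuckets x cs D).val.strings ↔ (∃ c ∈ cs, v = c ++ x) ∨ v ∈ D.strings := by
  induction cs generalizing D with
  | nil => simpa [addToBuckets] using hD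
  | cons c cs ih =>
    obtain ⟨h₁, h₂⟩ := BitTree.add_spec hD (w := c ++ x) (by simp [hx, hcs c])
    obtain ⟨h₃, h₄⟩ := ih (fun c hc => hcs c (by simp [hc])) h₁
    refine ⟨h₃, fun v => ?_⟩
    simp only [addToBuckets, Timed.val_bind, h₄, h₂, List.mem_cons, exists_eq_or_imp]
    exact or_left_comm.trans or_assoc.symm

theorem insertList_spec {K : Codes} (hK : ValidCodes K) (r : ℕ) {n : ℕ} (hn : totalLength K = n)
    {L : List Word} (hL : ∀ x ∈ L, x.length = n) {D : BitTree} (hD : Reduced (n + n) D) :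
    Reduced (n + n) (insertList K r L D).val ∧
      ∀ v, v ∈ (insertList K r L D).val.strings ↔
        (∃ x ∈ L, ∃ c ∈ (closeFilters K r x).val, v = c ++ x) ∨ v ∈ D.strings := by
  induction L generalizing D with
  | nil => simpa [insertList] using hD
  | cons x L ih =>
    have hx := hL x (by simp)
    obtain ⟨h₁, h₂⟩ := addToBuckets_spec hx (cs := (closeFilters K r x).val)
      (fun c hc => (length_of_mem_closeFilters hK (hx.trans hn.symm) hc).trans hn) hD
    obtain ⟨h₃, h₄⟩ := ih (fun x hx => hL x (by simp [hx])) h₁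
    refine ⟨h₃, fun v => ?_⟩
    have h₅ : (insertList K r (x :: L) D).val
      = (insertList K r L (addToBuckets x (closeFilters K r x).val D).val).val := rfl
    simp only [h₅, h₄, h₂, List.mem_cons, exists_eq_or_imp]
    exact or_left_comm.trans or_assoc.symm

/-- The vectors of `L` within distance `r` of `c`. -/
def wordBucket (r : ℕ) (L : List Word) (c : Word) : Finset Word :=
  L.toFinset.filter fun x => (dist c x).val ≤ r

/-- After preprocessing, the subtree below a filter vector stores its bucket. -/
theorem find_preprocess_spec {K : Codes} (hK : ValidCodes K) (r : ℕ) {n : ℕ}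
    (hn : totalLength K = n) {L : List Word} (hL : ∀ x ∈ L, x.length = n) {c : Word}
    (hc : c ∈ allWords K) :
    Reduced n (BitTree.find c (preprocess K r L).val).val ∧
      (BitTree.find c (preprocess K r L).val).val.strings.toFinset = wordBucket r L c := by
  have hcn := (length_of_mem_allWords hK hc).trans hn
  obtain ⟨h₁, h₂⟩ := insertList_spec hK r hn hL (.empty _)
  have hpre : (preprocess K r L).val = (insertList K r L BitTree.empty).val := rfl
  obtain ⟨h₃, h₄⟩ := BitTree.find_spec (w := c) (d := n) (t := (preprocess K r L).val)
    (by rw [hcn]; exact h₁)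
  refine ⟨h₃, Finset.ext fun v => ?_⟩
  rw [List.mem_toFinset, h₄, hpre, h₂, wordBucket, Finset.mem_filter, List.mem_toFinset]
  simp only [BitTree.strings_empty, List.not_mem_nil, or_false]
  constructor
  · rintro ⟨x, hx, c', hc', h⟩
    have hc'' := (length_of_mem_closeFilters hK ((hL x hx).trans hn.symm) hc').trans hn
    -- Filter vectors have equal length, so `c ++ v` determines both `c` and `v`.
    obtain ⟨rfl, rfl⟩ := List.append_inj h (hcn.trans hc''.symm)
    rw [closeFilters_val hK r v ((hL v hx).trans hn.symm), List.mem_filter] at hc'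
    exact ⟨hx, by simpa using hc'.2⟩
  · rintro ⟨hv, hd⟩
    refine ⟨v, hv, c, ?_, rfl⟩
    rw [closeFilters_val hK r v ((hL v hv).trans hn.symm), List.mem_filter]
    exact ⟨hc, by simpa using hd⟩

/-! ## Queries -/

theorem length_le_addClose_cost (rc : ℕ) (q : Word) (xs : List Word) (S : BitTree) :
    xs.length ≤ (addClose rc q xs S).cost := by
  induction xs generalizing S with
  | nil => simp
  | cons x xs ih =>
    simp only [addClose, Timed.cost_bind, Timed.cost_tick, List.length_cons]
    split
    · have := ih (BitTree.add x S).val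
      simp only [Timed.cost_bind]
      omega
    · have := ih S
      omega

theorem addClose_cost_le (rc : ℕ) (q : Word) {n : ℕ} {xs : List Word}
    (hxs : ∀ x ∈ xs, x.length = n) (S : BitTree) :
    (addClose rc q xs S).cost ≤ (2 * n + 2) * xs.length := by
  induction xs generalizing S with
  | nil => simp [addClose]
  | cons x xs ih =>
    have hx := hxs x (by simp)
    have hd := dist_cost_le x q
    simp only [addClose, Timed.cost_bind, Timed.cost_tick, List.length_cons, mul_add]
    split
    · have := ih (fun x hx => hxs x (by simp [hx])) (BitTree.add x S).val
      simp only [Timed.cost_bind, BitTree.add_cost]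
      omega
    · have := ih (fun x hx => hxs x (by simp [hx])) S
      omega

theorem le_scanBuckets_cost (rc : ℕ) (q : Word) (D : BitTree) (cs : List Word) (S : BitTree) :
    (cs.map fun c => 1 + (BitTree.find c D).val.strings.length).sum
      ≤ (scanBuckets rc q D cs S).cost := by
  induction cs generalizing S with
  | nil => simp
  | cons c cs ih =>
    have h₁ := ih (addClose rc q (BitTree.find c D).val.toList.val S).val
    have h₂ := length_le_addClose_cost rc q (BitTree.find c D).val.toList.val S
    simp only [scanBuckets, Timed.cost_bind, Timed.cost_tick, List.map_cons, List.sum_cons, strings]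
      at *
    omega

/-- Per filter vector the fixed cost is `n + 3`; per vector of its bucket, listing costs at most `3
n` and testing at most `2 n + 2`. The factor `5 n + 3` covers both. -/
theorem scanBuckets_cost_le (rc : ℕ) (q : Word) {D : BitTree} {n : ℕ} {cs : List Word}
    (hlen : ∀ c ∈ cs, c.length = n) (hcs : ∀ c ∈ cs, Reduced n (BitTree.find c D).val)
    (S : BitTree) :
    (scanBuckets rc q D cs S).cost ≤
      (5 * n + 3) * (cs.map fun c => 1 + (BitTree.find c D).val.strings.length).sum := by
  induction cs generalizing S with
  | nil => simp [scanBuckets]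
  | cons c cs ih =>
    have h₁ := ih (fun c hc => hlen c (by simp [hc])) (fun c hc => hcs c (by simp [hc]))
      (addClose rc q (BitTree.find c D).val.toList.val S).val
    have h₂ := addClose_cost_le rc q (fun x hx => (hcs c (by simp)).length_eq hx) S
    have h₃ := BitTree.toList_cost_le (hcs c (by simp))
    have h₄ := hlen c (by simp)
    simp only [scanBuckets, Timed.cost_bind, Timed.cost_tick, List.map_cons, List.sum_cons,
      BitTree.find_cost, mul_add, strings] at *
    nlinarith

section

variable {K : Codes} (hK : ValidCodes K) (ra rb rc : ℕ) {n S : ℕ} {q : Word}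
  (hn : totalLength K = n) (hS : totalSize K = S) (hq : q.length = n)
  {L : List Word} (hL : ∀ x ∈ L, x.length = n)
include hK hn hq hL

theorem sum_bucket_sizes : ((closeFilters K rb q).val.map fun c =>
      1 + (BitTree.find c (preprocess K ra L).val).val.strings.length).sum
    = ((closeFilters K rb q).val.map fun c => 1 + (wordBucket ra L c).card).sum := by
  congr 1
  refine List.map_congr_left fun c hc => ?_
  rw [closeFilters_val hK rb q (hq.trans hn.symm)] at hc
  rw [← (find_preprocess_spec hK ra hn hL (List.mem_of_mem_filter hc)).2,
    List.toFinset_card_of_nodup (BitTree.nodup_strings _)]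

theorem le_query_cost :
    1 + ((closeFilters K rb q).val.map fun c => 1 + (wordBucket ra L c).card).sum
      ≤ (query K rb rc q (preprocess K ra L).val).cost := by
  rw [← sum_bucket_sizes hK ra rb hn hq hL]
  exact Nat.add_le_add (one_le_closeFilters_cost K rb q) (le_scanBuckets_cost rc q _ _ _)

include hS in
theorem query_cost_le : (query K rb rc q (preprocess K ra L).val).cost ≤
    (decodingFactor n S + (5 * n + 3)) *
      (1 + ((closeFilters K rb q).val.map fun c => 1 + (wordBucket ra L c).card).sum) := by
  have hclose : ∀ c ∈ (closeFilters K rb q).val, c ∈ allWords K := fun c hc => by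
    rw [closeFilters_val hK rb q (hq.trans hn.symm)] at hc
    exact List.mem_of_mem_filter hc
  have h₁ := closeFilters_cost_le hK rb q hn hS
  have h₂ := scanBuckets_cost_le rc q (D := (preprocess K ra L).val)
    (fun c hc => (length_of_mem_allWords hK (hclose c hc)).trans hn)
    (fun c hc => (find_preprocess_spec hK ra hn hL (hclose c hc)).1) BitTree.empty
  rw [sum_bucket_sizes hK ra rb hn hq hL] at h₂
  -- The decoding cost is charged to the `1` that each close filter vector contributes, even if its
  -- bucket is empty.
  have h₃ : (closeFilters K rb q).val.length
      ≤ ((closeFilters K rb q).val.map fun c => 1 + (wordBucket ra L c).card).sum := by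
    generalize (closeFilters K rb q).val = cs
    induction cs with
    | nil => simp
    | cons c cs ih =>
      simp only [List.length_cons, List.map_cons, List.sum_cons]
      omega
  have h₄ : (query K rb rc q (preprocess K ra L).val).cost = (closeFilters K rb q).cost +
      (scanBuckets rc q (preprocess K ra L).val (closeFilters K rb q).val BitTree.empty).cost := rfl
  have h₅ := Nat.mul_le_mul_left (decodingFactor n S) h₃
  rw [h₄]
  simp only [add_mul, mul_add] at *
  omega

end

/-! ## Random vectors -/

theorem expect_prod {ι κ : Type*} [Fintype ι] [Fintype κ] (f : ι × κ → ℝ) :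
    𝔼 p, f p = 𝔼 i, 𝔼 j, f (i, j) := by
  rw [← Finset.univ_product_univ, Finset.expect_product]

theorem expect_coordinate {ι X : Type*} [Fintype ι] [DecidableEq ι] [Fintype X] [Nonempty X]
    (i : ι) (f : X → ℝ) : 𝔼 K : ι → X, f (K i) = 𝔼 x, f x := by
  refine (Fintype.expect_equiv (Equiv.piSplitAt i fun _ => X) _
    (fun p : X × ({j // j ≠ i} → X) => f p.1) fun _ => rfl).trans ?_
  simp only [expect_prod, Fintype.expect_const]

theorem expect_append {m n : ℕ} (g : Word → ℝ) :
    𝔼 v : Fin (m + n) → ZMod 2, g (List.ofFn v)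
      = 𝔼 u : Fin m → ZMod 2, 𝔼 v : Fin n → ZMod 2, g (List.ofFn u ++ List.ofFn v) := by
  rw [← expect_prod fun p : (Fin m → ZMod 2) × (Fin n → ZMod 2) =>
    g (List.ofFn p.1 ++ List.ofFn p.2)]
  refine (Fintype.expect_equiv (Fin.appendEquiv m n) _ _ fun p => ?_).symm
  simp [Fin.appendEquiv, List.ofFn_fin_append]

theorem sum_flatMap {ι : Type*} (l : List ι) (f : ι → List Word) (g : Word → ℝ) :
    ((l.flatMap f).map g).sum = (l.map fun i => ((f i).map g).sum).sum := by
  induction l with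
  | nil => simp
  | cons a l ih => simp [ih]

/-- Every filter vector of a random product code is uniformly distributed. -/
theorem expect_sum_allWords {ℓ : ℕ} (len size : Fin ℓ → ℕ) (g : Word → ℝ) :
    𝔼 K : (i : Fin ℓ) → Fin (size i) → Fin (len i) → ZMod 2,
      ((allWords (List.ofFn fun i => (len i, List.ofFn fun a => List.ofFn (K i a)))).map g).sum
    = (∏ i, size i : ℕ) * 𝔼 v : Fin (∑ i, len i) → ZMod 2, g (List.ofFn v) := by
  induction ℓ generalizing g with
  | zero =>
    have h : ∀ v : Fin (∑ i, len i) → ZMod 2, List.ofFn v = [] :=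
      fun v => List.length_eq_zero_iff.1 (by simp)
    simp only [h, Fintype.expect_const]
    simp [allWords]
  | succ ℓ ih =>
    -- As `g` takes lists, splitting the dimension needs no transport of vectors between types.
    have hsum : 𝔼 v : Fin (∑ i, len i) → ZMod 2, g (List.ofFn v)
        = 𝔼 v : Fin (len 0 + ∑ i : Fin ℓ, len i.succ) → ZMod 2, g (List.ofFn v) := by
      rw [Fin.sum_univ_succ]
    rw [hsum, expect_append]
    rw [← Fintype.expect_equiv (Fin.consEquiv fun i => Fin (size i) → Fin (len i) → ZMod 2)
      (fun p => ∑ a : Fin (size 0), ((allWords (List.ofFn fun i : Fin ℓ =>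
        (len i.succ, List.ofFn fun a => List.ofFn (p.2 i a)))).map
          fun w => g (List.ofFn (p.1 a) ++ w)).sum) _ fun p => ?_]
    · rw [expect_prod]
      simp only [Finset.expect_sum_comm, ih (fun i => len i.succ) (fun i => size i.succ),
        ← Finset.mul_expect]
      rw [← Finset.mul_sum]
      -- Only the marginal law of each codeword of the first short code enters; its independence of
      -- the other blocks was used by averaging over the two parts separately.
      simp only [expect_coordinate _ fun x : Fin (len 0) → ZMod 2 =>
        𝔼 v : Fin (∑ i : Fin ℓ, len i.succ) → ZMod 2, g (List.ofFn x ++ List.ofFn v)]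
      rw [Finset.sum_const, Finset.card_univ, Fintype.card_fin, Fin.prod_univ_succ, nsmul_eq_mul]
      push_cast
      ring
    · simp only [List.ofFn_succ, allWords, sum_flatMap, List.map_map, Fin.consEquiv, Equiv.coe_fn_mk,
        Fin.cons_zero, Fin.cons_succ]
      rw [List.map_ofFn, List.sum_ofFn]
      rfl

theorem dist_ofFn {n : ℕ} (v w : Fin n → ZMod 2) :
    (dist (List.ofFn v) (List.ofFn w)).val = hammingDist v w := by
  induction n with
  | zero => simp [dist, hammingDist]
  | succ n ih =>
    rw [List.ofFn_succ, List.ofFn_succ, dist_cons, ih]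
    simp only [hammingDist, Finset.card_filter, Fin.sum_univ_succ, ne_eq, ite_not]
    rw [add_comm]

/-- The set of coordinates in which a bit string differs from `q` determines the bit string. -/
noncomputable def differenceEquiv {n : ℕ} (q : Fin n → ZMod 2) :
    (Fin n → ZMod 2) ≃ Finset (Fin n) :=
  Equiv.ofBijective (fun v => Finset.univ.filter fun i => v i ≠ q i) <| by
    rw [Fintype.bijective_iff_injective_and_card]
    refine ⟨fun v w h => funext fun i => ?_, by simp [ZMod.card]⟩
    have hi : v i ≠ q i ↔ w i ≠ q i := by simpa using congrArg (i ∈ ·) h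
    have : ∀ a b c : ZMod 2, (a ≠ c ↔ b ≠ c) → a = b := by decide
    exact this _ _ _ hi

theorem card_hammingBall {n : ℕ} (q : Fin n → ZMod 2) {r : ℕ} (hr : r ≤ n) :
    ∑ v : Fin n → ZMod 2, (if hammingDist v q ≤ r then (1 : ℝ) else 0) = ballVol n r := by
  refine (Fintype.sum_equiv (differenceEquiv q) _
    (fun s : Finset (Fin n) => if s.card ≤ r then (1 : ℝ) else 0) fun v => rfl).trans ?_
  rw [← Finset.powerset_univ,
    Finset.sum_powerset_apply_card (fun k => if k ≤ r then (1 : ℝ) else 0), Finset.card_univ,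
    Fintype.card_fin, ballVol, Nat.cast_sum]
  simp only [nsmul_eq_mul, mul_ite, mul_one, mul_zero]
  rw [← Finset.sum_filter]
  refine Finset.sum_congr (Finset.ext fun i => ?_) fun _ _ => rfl
  simp only [Finset.mem_filter, Finset.mem_range]
  omega

theorem expect_hammingBall {δ : ℝ} (hδ₀ : 0 ≤ δ) (hδ₁ : δ ≤ 1 / 2) {n : ℕ} (q : Fin n → ZMod 2) :
    𝔼 v : Fin n → ZMod 2, (if hammingDist v q ≤ radius δ n then (1 : ℝ) else 0) = ballFrac δ n := by
  rw [Fintype.expect_eq_sum_div_card, card_hammingBall q (radius_le_dim hδ₀ hδ₁ n), ballFrac]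
  simp [ZMod.card]

/-! ## The expected bucket size -/

/-- The probability that a fixed vector occurs in a list of `N` independent uniform vectors. -/
noncomputable def hitProb (n N : ℕ) : ℝ := 1 - (1 - 1 / 2 ^ n) ^ N

/-- The vector is missed when all `N` independent draws avoid it, each with probability `1 - 2 ^
(-n)`. -/
theorem expect_mem_image {n N : ℕ} (v : Fin n → ZMod 2) :
    𝔼 L : Fin N → Fin n → ZMod 2, (if v ∈ Finset.univ.image L then (1 : ℝ) else 0)
      = hitProb n N := by
  have hmiss : 𝔼 x : Fin n → ZMod 2, (if x = v then (0 : ℝ) else 1) = 1 - 1 / 2 ^ n := by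
    have : ∀ x : Fin n → ZMod 2, (if x = v then (0 : ℝ) else 1) = 1 - if x = v then 1 else 0 :=
      fun x => by split <;> simp
    simp only [this]
    rw [Finset.expect_sub_distrib, Fintype.expect_const, Fintype.expect_eq_sum_div_card]
    simp [ZMod.card]
  have hpow := Finset.expect_pow (Finset.univ : Finset (Fin n → ZMod 2))
    (fun x => if x = v then (0 : ℝ) else 1) N
  rw [hmiss, Fintype.piFinset_univ] at hpow
  have : ∀ L : Fin N → Fin n → ZMod 2, (if v ∈ Finset.univ.image L then (1 : ℝ) else 0)
      = 1 - ∏ k, if L k = v then (0 : ℝ) else 1 := by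
    intro L
    split
    · rename_i h
      obtain ⟨k, _, hk⟩ := Finset.mem_image.1 h
      rw [Finset.prod_eq_zero (Finset.mem_univ k) (by simp [hk]), sub_zero]
    · rename_i h
      rw [Finset.prod_eq_one fun k _ => ?_, sub_self]
      rw [if_neg]
      rintro rfl
      exact h (Finset.mem_image_of_mem _ (Finset.mem_univ k))
  simp only [this]
  rw [Finset.expect_sub_distrib, Fintype.expect_const, ← hpow, hitProb]

theorem le_radius_iff {δ : ℝ} (hδ₀ : 0 ≤ δ) (n d : ℕ) : d ≤ radius δ n ↔ (d : ℝ) ≤ δ * n :=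
  Nat.le_floor_iff (by positivity)

/-- Linearity is applied over the points of the ball rather than the entries of the list, since
repeated entries count once. The value does not depend on `c`. -/
theorem expBucket_eq {α : ℝ} (hα₀ : 0 ≤ α) (hα₁ : α ≤ 1 / 2) {n : ℕ} (N : ℕ)
    (c : Fin n → ZMod 2) : expBucket α N c = ballVol n (radius α n) * hitProb n N := by
  have hcard : ∀ L : Fin N → Fin n → ZMod 2, ((bucket α L c).card : ℝ)
      = ∑ v, (if hammingDist v c ≤ radius α n then (1 : ℝ) else 0) *
          if v ∈ Finset.univ.image L then 1 else 0 := by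
    intro L
    rw [bucket, Finset.card_eq_sum_ones, Nat.cast_sum, Finset.sum_filter,
      ← Finset.sum_subset (Finset.subset_univ (Finset.univ.image L))
        fun v _ hv => by rw [if_neg hv, mul_zero]]
    refine Finset.sum_congr rfl fun v hv => ?_
    rw [if_pos hv, mul_one]
    simp only [le_radius_iff hα₀, Nat.cast_one]
  simp only [expBucket, hcard, Finset.expect_sum_comm]
  simp only [← Finset.mul_expect, expect_mem_image]
  rw [← Finset.sum_mul, card_hammingBall c (radius_le_dim hα₀ hα₁ n)]

/-- The union bound, in the form of Bernoulli's inequality. -/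
theorem hitProb_le (n N : ℕ) : 2 ^ n * hitProb n N ≤ N := by
  have h₁ : (1 : ℝ) / 2 ^ n ≤ 1 := by
    rw [div_le_one (by positivity)]
    exact one_le_pow₀ one_le_two
  have h₂ := one_add_mul_le_pow (a := -((1 : ℝ) / 2 ^ n)) (by linarith) N
  have h₃ : hitProb n N ≤ N * (1 / 2 ^ n) := by
    rw [hitProb, sub_eq_add_neg 1 ((1 : ℝ) / 2 ^ n)]
    linarith
  calc 2 ^ n * hitProb n N ≤ 2 ^ n * (N * (1 / 2 ^ n)) := by gcongr
    _ = N := by field_simp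

/-- Repetitions cost at most a factor `2`. With `p = 2 ^ (-n)`, `(1 - p) ^ N (1 + N p) ≤ (1 - p ^ 2)
^ N ≤ 1`, so the hit probability is at least `N p / (1 + N p)`, and `N p ≤ 1`. -/
theorem le_hitProb {n N : ℕ} (hN : N ≤ 2 ^ n) : (N : ℝ) ≤ 2 * (2 ^ n * hitProb n N) := by
  set p : ℝ := 1 / 2 ^ n with hp
  have hp₀ : 0 ≤ p := by positivity
  have hp₁ : p ≤ 1 := by
    rw [hp, div_le_one (by positivity)]
    exact one_le_pow₀ one_le_two
  have hN' : (N : ℝ) ≤ 2 ^ n := by exact_mod_cast hN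
  have hNp : N * p ≤ 1 := by
    rw [hp, mul_one_div, div_le_one (by positivity)]
    exact hN'
  have hNp₀ : 0 ≤ N * p := by positivity
  have h₁ : (1 - p) ^ N * (1 + N * p) ≤ 1 := by
    calc (1 - p) ^ N * (1 + N * p) ≤ (1 - p) ^ N * (1 + p) ^ N := by
          have := one_add_mul_le_pow (a := p) (by linarith) N
          have h0 : 0 ≤ 1 - p := by linarith
          gcongr
      _ = (1 - p ^ 2) ^ N := by rw [← mul_pow]; ring_nf
      _ ≤ 1 := pow_le_one₀ (by nlinarith) (by nlinarith)
  have h₂ : N * p ≤ 2 * (1 - (1 - p) ^ N) := by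
    nlinarith [pow_nonneg (sub_nonneg.2 hp₁) N]
  have h₃ : (2 : ℝ) ^ n * p = 1 := by rw [hp]; field_simp
  calc (N : ℝ) = 2 ^ n * (N * p) := by rw [mul_left_comm, h₃, mul_one]
    _ ≤ 2 ^ n * (2 * (1 - (1 - p) ^ N)) := by gcongr
    _ = _ := by rw [hitProb]; ring

theorem expBucket_nonneg (α : ℝ) (N : ℕ) {n : ℕ} (c : Fin n → ZMod 2) : 0 ≤ expBucket α N c :=
  Finset.expect_nonneg fun _ _ => Nat.cast_nonneg _

theorem expBucket_subexpEq {α : ℝ} (hα₀ : 0 ≤ α) (hα₁ : α ≤ 1 / 2) {N : ℕ → ℕ}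
    (hN : ∀ n, N n ≤ 2 ^ n) (c : ∀ n : ℕ, Fin n → ZMod 2) :
    SubexpEq (fun n => expBucket α (N n) (c n)) (fun n => N n * rate α n) := by
  have heq : ∀ n, expBucket α (N n) (c n) = (2 ^ n * hitProb n (N n)) * ballFrac α n := fun n => by
    rw [expBucket_eq hα₀ hα₁, ballFrac]
    field_simp
  refine SubexpEq.trans (g := fun n => N n * ballFrac α n) ⟨.of_le fun n => ?_, ?_⟩
    ((ballFrac_subexpEq_rate hα₀ hα₁).const_mul fun n => Nat.cast_nonneg _)
  · rw [heq]
    exact mul_le_mul_of_nonneg_right (hitProb_le n (N n)) (ballFrac_nonneg α n)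
  · refine .of_le_mul (.const 2) (fun n => expBucket_nonneg _ _ _) fun n => ?_
    rw [heq, ← mul_assoc]
    exact mul_le_mul_of_nonneg_right (le_hitProb (hN n)) (ballFrac_nonneg α n)

/-! ## Random product codes -/

namespace Shape

variable {n : ℕ} {P : Shape n} (K : P.Code)

theorem validCodes_toCodes : ValidCodes (toCodes K) := by
  intro p hp
  obtain ⟨i, rfl⟩ := (List.mem_ofFn' _ _).1 hp
  refine ⟨fun h => (P.size_pos i).ne' ?_, fun c hc => ?_⟩
  · simpa using congrArg List.length h
  · obtain ⟨a, rfl⟩ := (List.mem_ofFn' _ _).1 hc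
    simp

theorem totalLength_toCodes : totalLength (toCodes K) = n := by
  rw [totalLength, toCodes, List.map_ofFn, List.sum_ofFn]
  exact P.sum_len

theorem totalSize_toCodes : totalSize (toCodes K) = P.numCodewords := by
  rw [totalSize, toCodes, List.map_ofFn, List.sum_ofFn]
  simp [numCodewords]

end Shape

theorem sum_filter (l : List Word) (p : Word → Prop) [DecidablePred p] (g : Word → ℝ) :
    ((l.filter fun w => p w).map g).sum = (l.map fun w => if p w then g w else 0).sum := by
  induction l with
  | nil => rfl
  | cons a l ih => by_cases h : p a <;> simp [h, ih]

/-- The expectation of a sum over the filter vectors close to a given point, if the summand has a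
constant expectation. -/
theorem expect_sum_closeFilters {δ : ℝ} (hδ₀ : 0 ≤ δ) (hδ₁ : δ ≤ 1 / 2) {n : ℕ} (P : Shape n)
    (x : Fin n → ZMod 2) {g : Word → ℝ} {e : ℝ} (hg : ∀ v : Fin n → ZMod 2, g (List.ofFn v) = e) :
    𝔼 K : P.Code,
      ((closeFilters (Shape.toCodes K) (radius δ n) (List.ofFn x)).val.map g).sum
    = P.numFilters * ballFrac δ n * e := by
  have h : ∀ K : P.Code,
      ((closeFilters (Shape.toCodes K) (radius δ n) (List.ofFn x)).val.map g).sum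
      = ((allWords (Shape.toCodes K)).map fun w =>
          if (dist w (List.ofFn x)).val ≤ radius δ n then g w else 0).sum := fun K => by
    rw [closeFilters_val (Shape.validCodes_toCodes K) _ _
      (by rw [List.length_ofFn, Shape.totalLength_toCodes]), sum_filter]
  simp only [h]
  -- Substituting `n = ∑ i, len i` matches the form of `expect_sum_allWords`.
  obtain ⟨ℓ, len, size, rfl, hsize⟩ := P
  refine (expect_sum_allWords len size _).trans ?_
  rw [← expect_hammingBall hδ₀ hδ₁ x, mul_assoc, Finset.expect_mul]
  simp only [dist_ofFn, hg, ite_mul, one_mul, zero_mul]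
  rfl

theorem expect_one_add_length_closeFilters {δ : ℝ} (hδ₀ : 0 ≤ δ) (hδ₁ : δ ≤ 1 / 2) {n : ℕ}
    (P : Shape n) (x : Fin n → ZMod 2) :
    𝔼 K : P.Code, ((1 + (closeFilters (Shape.toCodes K) (radius δ n)
      (List.ofFn x)).val.length : ℕ) : ℝ) = 1 + P.numFilters * ballFrac δ n := by
  have h := expect_sum_closeFilters hδ₀ hδ₁ P x (g := fun _ => 1) fun _ => rfl
  simp only [List.map_const', List.sum_replicate, nsmul_eq_mul, mul_one] at h
  push_cast
  rw [Finset.expect_add_distrib, h, Fintype.expect_const]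

theorem wordBucket_card {α : ℝ} (hα₀ : 0 ≤ α) {n N : ℕ} (L : Fin N → Fin n → ZMod 2)
    (v : Fin n → ZMod 2) :
    (wordBucket (radius α n) (toWords L) (List.ofFn v)).card = (bucket α L v).card := by
  rw [← Finset.card_image_of_injective _ (List.ofFn_injective (n := n))]
  congr 1
  ext w
  simp only [wordBucket, bucket, toWords, Finset.mem_filter, List.mem_toFinset, Finset.mem_image,
    Finset.mem_univ, true_and, List.mem_ofFn', Set.mem_range]
  constructor
  · rintro ⟨⟨k, rfl⟩, h⟩
    rw [dist_ofFn, hammingDist_comm] at h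
    exact ⟨L k, ⟨⟨k, rfl⟩, (le_radius_iff hα₀ _ _).1 h⟩, rfl⟩
  · rintro ⟨_, ⟨⟨k, rfl⟩, h⟩, rfl⟩
    rw [dist_ofFn, hammingDist_comm]
    exact ⟨⟨k, rfl⟩, (le_radius_iff hα₀ _ _).2 h⟩

theorem expect_sum_list {ι : Type*} [Fintype ι] (l : List Word) (g : ι → Word → ℝ) :
    𝔼 i, (l.map (g i)).sum = (l.map fun w => 𝔼 i, g i w).sum := by
  induction l with
  | nil => simp
  | cons a l ih => simp [Finset.expect_add_distrib, ih]

theorem cast_sum_map {ι : Type*} (l : List ι) (g : ι → ℕ) :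
    (((l.map g).sum : ℕ) : ℝ) = (l.map fun i => (g i : ℝ)).sum := by
  induction l with
  | nil => simp
  | cons a l ih => simp [ih]

/-- The average over the list is taken with the code fixed. It gives every filter vector the same
mean `1 + expBucket α N c`, whatever the centre, so `c` is arbitrary. -/
theorem expect_sum_buckets {α β : ℝ} (hα₀ : 0 ≤ α) (hα₁ : α ≤ 1 / 2) (hβ₀ : 0 ≤ β)
    (hβ₁ : β ≤ 1 / 2) {n : ℕ} (P : Shape n) (N : ℕ) (q c : Fin n → ZMod 2) :
    𝔼 ω : P.Code × (Fin N → Fin n → ZMod 2),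
      ((1 + ((closeFilters (Shape.toCodes ω.1) (radius β n) (List.ofFn q)).val.map fun w =>
        1 + (wordBucket (radius α n) (toWords ω.2) w).card).sum : ℕ) : ℝ)
    = 1 + P.numFilters * ballFrac β n * (1 + expBucket α N c) := by
  have hmean : ∀ v : Fin n → ZMod 2, 𝔼 L : Fin N → Fin n → ZMod 2,
      ((1 + (wordBucket (radius α n) (toWords L) (List.ofFn v)).card : ℕ) : ℝ)
        = 1 + expBucket α N c := fun v => by
    simp only [wordBucket_card hα₀, Nat.cast_add, Nat.cast_one]
    rw [Finset.expect_add_distrib, Fintype.expect_const, expBucket_eq hα₀ hα₁ N c,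
      ← expBucket_eq hα₀ hα₁ N v, expBucket]
  rw [expect_prod]
  simp only [Nat.cast_add 1 (List.sum _), Nat.cast_one, cast_sum_map]
  simp only [Finset.expect_add_distrib _ (fun _ => (1 : ℝ)), Fintype.expect_const, expect_sum_list]
  rw [expect_sum_closeFilters hβ₀ hβ₁ P q hmean]

/-! ## Expected costs -/

section Costs

variable {n : ℕ} (P : Shape n)

theorem expInsert_bounds {α : ℝ} (hα₀ : 0 ≤ α) (hα₁ : α ≤ 1 / 2) (x : Fin n → ZMod 2)
    (D : P.Code → BitTree) :
    1 + P.numFilters * ballFrac α n ≤ expInsert α P x D ∧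
      expInsert α P x D ≤
        updateFactor n P.numCodewords * (1 + P.numFilters * ballFrac α n) := by
  rw [← expect_one_add_length_closeFilters hα₀ hα₁ P x, Finset.mul_expect]
  refine ⟨Finset.expect_le_expect fun K _ => ?_, Finset.expect_le_expect fun K _ => ?_⟩
  · exact_mod_cast le_insert_cost _ _ _ _
  · exact_mod_cast insert_cost_le (Shape.validCodes_toCodes K) (Shape.totalLength_toCodes K)
      (Shape.totalSize_toCodes K) List.length_ofFn (D K)

theorem expRemove_bounds {α : ℝ} (hα₀ : 0 ≤ α) (hα₁ : α ≤ 1 / 2) (x : Fin n → ZMod 2)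
    (D : P.Code → BitTree) :
    1 + P.numFilters * ballFrac α n ≤ expRemove α P x D ∧
      expRemove α P x D ≤
        updateFactor n P.numCodewords * (1 + P.numFilters * ballFrac α n) := by
  rw [← expect_one_add_length_closeFilters hα₀ hα₁ P x, Finset.mul_expect]
  refine ⟨Finset.expect_le_expect fun K _ => ?_, Finset.expect_le_expect fun K _ => ?_⟩
  · exact_mod_cast le_remove_cost _ _ _ _
  · exact_mod_cast remove_cost_le (Shape.validCodes_toCodes K) (Shape.totalLength_toCodes K)
      (Shape.totalSize_toCodes K) List.length_ofFn (D K)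

theorem length_of_mem_toWords {N : ℕ} (L : Fin N → Fin n → ZMod 2) :
    ∀ x ∈ toWords L, x.length = n := fun x hx => by
  obtain ⟨k, rfl⟩ := (List.mem_ofFn' _ _).1 hx
  simp

/-- The average over the code is already the same for each fixed vector, so the law of the list
plays no role. -/
theorem expect_sum_toWords {α : ℝ} (hα₀ : 0 ≤ α) (hα₁ : α ≤ 1 / 2) (N : ℕ) :
    𝔼 ω : P.Code × (Fin N → Fin n → ZMod 2), ((((toWords ω.2).map fun x =>
        1 + (closeFilters (Shape.toCodes ω.1) (radius α n) x).val.length).sum : ℕ) : ℝ)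
      = N * (1 + P.numFilters * ballFrac α n) := by
  rw [expect_prod, Finset.expect_comm]
  simp only [toWords, List.map_ofFn, List.sum_ofFn, Function.comp_apply]
  simp only [Nat.cast_sum, Finset.expect_sum_comm,
    expect_one_add_length_closeFilters hα₀ hα₁ P, Finset.sum_const, Finset.card_univ,
    Fintype.card_fin, nsmul_eq_mul]
  rw [Fintype.expect_const]

theorem expPreprocess_bounds {α : ℝ} (hα₀ : 0 ≤ α) (hα₁ : α ≤ 1 / 2) {N : ℕ} (hN : 1 ≤ N) :
    N * (1 + P.numFilters * ballFrac α n) ≤ expPreprocess α P N ∧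
      expPreprocess α P N ≤ (n * P.numCodewords + updateFactor n P.numCodewords + 1 : ℕ) *
        (N * (1 + P.numFilters * ballFrac α n)) := by
  have hcost : ∀ ω : P.Code × (Fin N → Fin n → ZMod 2),
      (preprocess (Shape.toCodes ω.1) (radius α n) (toWords ω.2)).cost
      = codeBits (Shape.toCodes ω.1) +
        (insertList (Shape.toCodes ω.1) (radius α n) (toWords ω.2) BitTree.empty).cost :=
    fun _ => rfl
  rw [← expect_sum_toWords P hα₀ hα₁ N, Finset.mul_expect]
  refine ⟨Finset.expect_le_expect fun ω _ => ?_, Finset.expect_le_expect fun ω _ => ?_⟩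
  · rw [hcost]
    exact_mod_cast (le_insertList_cost _ _ _ _).trans (Nat.le_add_left _ _)
  · have h₁ := codeBits_le (Shape.toCodes ω.1)
    rw [Shape.totalLength_toCodes, Shape.totalSize_toCodes] at h₁
    have h₂ := insertList_cost_le (Shape.validCodes_toCodes ω.1) (radius α n)
      (Shape.totalLength_toCodes ω.1) (Shape.totalSize_toCodes ω.1) (length_of_mem_toWords ω.2)
      BitTree.empty
    -- A nonempty list makes the count positive, which absorbs the cost of writing down the codes.
    have h₃ : 1 ≤ ((toWords ω.2).map fun x =>
        1 + (closeFilters (Shape.toCodes ω.1) (radius α n) x).val.length).sum := by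
      refine le_trans ?_ (List.length_le_sum_of_one_le _ fun i hi => ?_)
      · simpa [toWords] using hN
      · obtain ⟨x, _, rfl⟩ := List.mem_map.1 hi
        exact Nat.le_add_right 1 _
    rw [hcost]
    have h₄ := Nat.le_mul_of_pos_right (n * P.numCodewords) h₃
    norm_cast
    rw [add_assoc, add_mul]
    omega

theorem expQuery_bounds {α β : ℝ} (hα₀ : 0 ≤ α) (hα₁ : α ≤ 1 / 2) (hβ₀ : 0 ≤ β)
    (hβ₁ : β ≤ 1 / 2) (γ : ℝ) (N : ℕ) (q c : Fin n → ZMod 2) :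
    1 + P.numFilters * ballFrac β n * (1 + expBucket α N c) ≤ expQuery α β γ P N q ∧
      expQuery α β γ P N q ≤ (decodingFactor n P.numCodewords + (5 * n + 3) : ℕ) *
        (1 + P.numFilters * ballFrac β n * (1 + expBucket α N c)) := by
  rw [← expect_sum_buckets hα₀ hα₁ hβ₀ hβ₁ P N q c, Finset.mul_expect]
  refine ⟨Finset.expect_le_expect fun ω _ => ?_, Finset.expect_le_expect fun ω _ => ?_⟩
  · exact_mod_cast le_query_cost (Shape.validCodes_toCodes ω.1) _ _ _
      (Shape.totalLength_toCodes ω.1) List.length_ofFn (length_of_mem_toWords ω.2)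
  · exact_mod_cast query_cost_le (Shape.validCodes_toCodes ω.1) _ _ _
      (Shape.totalLength_toCodes ω.1) (Shape.totalSize_toCodes ω.1) List.length_ofFn
      (length_of_mem_toWords ω.2)

end Costs

/-- A quantity lying between `M (1 + F)` and a subexponential multiple of it. -/
theorem subexpEq_mul_max {T M F B : ℕ → ℝ} (hB : SubexpLE B (fun _ => 1)) (hB₀ : ∀ n, 0 ≤ B n)
    (hM : ∀ n, 0 ≤ M n) (hF : ∀ n, 0 ≤ F n)
    (h : ∀ n, M n * (1 + F n) ≤ T n ∧ T n ≤ B n * (M n * (1 + F n))) :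
    SubexpEq T (fun n => M n * max 1 (F n)) := by
  refine ⟨.of_le_mul (hB.mul_one (.const 2) fun _ => zero_le_two)
    (fun n => mul_nonneg (hM n) (zero_le_one.trans (le_max_left _ _))) fun n => ?_,
    .of_le fun n => le_trans ?_ (h n).1⟩
  · have : 1 + F n ≤ 2 * max 1 (F n) := by
      linarith [le_max_left 1 (F n), le_max_right 1 (F n)]
    calc T n ≤ B n * (M n * (1 + F n)) := (h n).2
      _ ≤ B n * (M n * (2 * max 1 (F n))) :=
        mul_le_mul_of_nonneg_left (mul_le_mul_of_nonneg_left this (hM n)) (hB₀ n)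
      _ = _ := by ring
  · exact mul_le_mul_of_nonneg_left (max_le (by linarith [hF n]) (by linarith)) (hM n)

theorem subexpEq_max {T F B : ℕ → ℝ} (hB : SubexpLE B (fun _ => 1)) (hB₀ : ∀ n, 0 ≤ B n)
    (hF : ∀ n, 0 ≤ F n) (h : ∀ n, 1 + F n ≤ T n ∧ T n ≤ B n * (1 + F n)) :
    SubexpEq T (fun n => max 1 (F n)) := by
  simpa using subexpEq_mul_max (M := fun _ => 1) hB hB₀ (fun _ => zero_le_one) hF
    fun n => by simpa using h n

/-! ### The work factors are subexponential -/

theorem decodingFactor_subexpLE {S : ℕ → ℕ} (hS : SubexpLE (fun n => (S n : ℝ)) (fun _ => 1)) :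
    SubexpLE (fun n => (decodingFactor n (S n) : ℝ)) (fun _ => 1) := by
  have h₁ := hS.add_one (.const 1)
  have h₂ := SubexpLE.natCast_add_one.add_one (.const 1)
  have h₃ := ((SubexpLE.const 3).mul_one h₂ fun n => by positivity).mul_one
    (h₁.mul_one h₁ fun n => by positivity) fun n => by positivity
  refine (SubexpLE.of_le fun n => le_of_eq ?_).trans h₃
  simp only [decodingFactor]
  push_cast
  ring

theorem linear_subexpLE (a b : ℕ) : SubexpLE (fun n => ((a * n + b : ℕ) : ℝ)) (fun _ => 1) := by
  refine (SubexpLE.of_le fun n => ?_).trans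
    ((SubexpLE.const (a + b)).mul_one .natCast_add_one fun n => by positivity)
  push_cast
  nlinarith [mul_nonneg (Nat.cast_nonneg (α := ℝ) b) (Nat.cast_nonneg (α := ℝ) n),
    Nat.cast_nonneg (α := ℝ) a]

theorem updateFactor_subexpLE {S : ℕ → ℕ} (hS : SubexpLE (fun n => (S n : ℝ)) (fun _ => 1)) :
    SubexpLE (fun n => (updateFactor n (S n) : ℝ)) (fun _ => 1) := by
  simp only [updateFactor, Nat.cast_add (decodingFactor _ _)]
  exact (decodingFactor_subexpLE hS).add_one (linear_subexpLE 3 2)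

end LSF

/-! ### Assembling the estimates -/

open LSF in
theorem theorem2 (α β γ : ℝ) (hα₀ : 0 ≤ α) (hα₁ : α ≤ 1 / 2) (hβ₀ : 0 ≤ β) (hβ₁ : β ≤ 1 / 2)
    (hγ₀ : 0 ≤ γ) (hγ₁ : γ ≤ 1 / 2)
    -- the filter vectors form a random product code of subexponentially small short codes
    (P : ∀ n : ℕ, Shape n) (hP : SubexpLE (fun n => ((P n).numCodewords : ℝ)) (fun _ => 1))
    -- the sizes of the lists
    (N : ℕ → ℕ) (hN₁ : ∀ n, 1 ≤ N n) (hN₂ : ∀ n, N n ≤ 2 ^ n) :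
    -- the expected size of each bucket
    (∀ c : ∀ n : ℕ, Fin n → ZMod 2,
      SubexpEq (fun n => expBucket α (N n) (c n)) (fun n => N n * rate α n)) ∧
    -- update
    (SubexpLE (fun _ => 1) (fun n => (P n).numFilters * rate α n) →
      ∀ (x : ∀ n : ℕ, Fin n → ZMod 2) (D : ∀ n : ℕ, (P n).Code → BitTree),
        SubexpEq (fun n => expInsert α (P n) (x n) (D n))
          (fun n => (P n).numFilters * rate α n) ∧
        SubexpEq (fun n => expRemove α (P n) (x n) (D n))
          (fun n => (P n).numFilters * rate α n)) ∧
    -- preprocessing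
    (SubexpLE (fun _ => 1) (fun n => (P n).numFilters * rate α n) →
      SubexpEq (fun n => expPreprocess α (P n) (N n))
        (fun n => N n * (P n).numFilters * rate α n)) ∧
    -- query
    (SubexpLE (fun _ => 1) (fun n => (P n).numFilters * rate β n) →
      SubexpLE (fun _ => 1) (fun n => N n * rate α n) →
      ∀ q c : ∀ n : ℕ, Fin n → ZMod 2,
        SubexpEq (fun n => expQuery α β γ (P n) (N n) (q n))
          (fun n => (P n).numFilters * rate β n * expBucket α (N n) (c n))) ∧
    -- the costs without any assumption on the numbers of filter vectors and of list vectors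
    (∀ (x : ∀ n : ℕ, Fin n → ZMod 2) (D : ∀ n : ℕ, (P n).Code → BitTree),
      SubexpEq (fun n => expInsert α (P n) (x n) (D n))
        (fun n => max 1 ((P n).numFilters * rate α n)) ∧
      SubexpEq (fun n => expRemove α (P n) (x n) (D n))
        (fun n => max 1 ((P n).numFilters * rate α n))) ∧
    SubexpEq (fun n => expPreprocess α (P n) (N n))
      (fun n => N n * max 1 ((P n).numFilters * rate α n)) ∧
    (∀ q c : ∀ n : ℕ, Fin n → ZMod 2,
      SubexpEq (fun n => expQuery α β γ (P n) (N n) (q n))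
        (fun n => max 1 ((P n).numFilters * rate β n * max 1 (expBucket α (N n) (c n))))) := by
  have hrα := ballFrac_subexpEq_rate hα₀ hα₁
  have hrβ := ballFrac_subexpEq_rate hβ₀ hβ₁
  have hC : ∀ n, (0 : ℝ) ≤ (P n).numFilters := fun n => Nat.cast_nonneg _
  have hfrac : ∀ δ n, 0 ≤ (P n).numFilters * ballFrac δ n :=
    fun δ n => mul_nonneg (hC n) (ballFrac_nonneg δ n)
  have hrate : ∀ δ n, 0 ≤ (P n).numFilters * rate δ n :=
    fun δ n => mul_nonneg (hC n) (rate_nonneg δ n)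
  have hmax : SubexpEq (fun n => max 1 ((P n).numFilters * ballFrac α n))
      (fun n => max 1 ((P n).numFilters * rate α n)) :=
    (SubexpEq.refl fun _ => 1).max (hrα.const_mul hC) (fun _ => zero_le_one) (hfrac α)
      (fun _ => zero_le_one) (hrate α)
  have hbucket := fun c => expBucket_subexpEq hα₀ hα₁ hN₂ c
  have hupd := updateFactor_subexpLE hP
  have hinsert : ∀ (x : ∀ n : ℕ, Fin n → ZMod 2) (D : ∀ n : ℕ, (P n).Code → BitTree),
      SubexpEq (fun n => expInsert α (P n) (x n) (D n))
        (fun n => max 1 ((P n).numFilters * rate α n)) := fun x D =>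
    (subexpEq_max hupd (fun n => Nat.cast_nonneg _) (hfrac α)
      fun n => expInsert_bounds (P n) hα₀ hα₁ (x n) (D n)).trans hmax
  have hremove : ∀ (x : ∀ n : ℕ, Fin n → ZMod 2) (D : ∀ n : ℕ, (P n).Code → BitTree),
      SubexpEq (fun n => expRemove α (P n) (x n) (D n))
        (fun n => max 1 ((P n).numFilters * rate α n)) := fun x D =>
    (subexpEq_max hupd (fun n => Nat.cast_nonneg _) (hfrac α)
      fun n => expRemove_bounds (P n) hα₀ hα₁ (x n) (D n)).trans hmax
  have hprep : SubexpEq (fun n => expPreprocess α (P n) (N n))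
      (fun n => N n * max 1 ((P n).numFilters * rate α n)) := by
    have hB : SubexpLE (fun n => ((n * (P n).numCodewords +
        updateFactor n (P n).numCodewords + 1 : ℕ) : ℝ)) (fun _ => 1) := by
      have hn := linear_subexpLE 1 0
      simp only [one_mul, add_zero] at hn
      push_cast
      exact ((hn.mul_one hP fun n => Nat.cast_nonneg _).add_one hupd).add_one (.const 1)
    exact (subexpEq_mul_max hB (fun n => Nat.cast_nonneg _) (fun n => Nat.cast_nonneg _) (hfrac α)
      fun n => expPreprocess_bounds (P n) hα₀ hα₁ (hN₁ n)).trans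
      (hmax.const_mul fun n => Nat.cast_nonneg _)
  have hquery : ∀ q c : ∀ n : ℕ, Fin n → ZMod 2,
      SubexpEq (fun n => expQuery α β γ (P n) (N n) (q n))
        (fun n => max 1 ((P n).numFilters * rate β n * max 1 (expBucket α (N n) (c n)))) := by
    intro q c
    have hE : ∀ n, 0 ≤ expBucket α (N n) (c n) := fun n => expBucket_nonneg _ _ _
    have hE₁ : ∀ n, 0 ≤ 1 + expBucket α (N n) (c n) := fun n => by linarith [hE n]
    have hE₂ : ∀ n, 0 ≤ max 1 (expBucket α (N n) (c n)) :=
      fun n => zero_le_one.trans (le_max_left _ _)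
    have hone : SubexpEq (fun n => 1 + expBucket α (N n) (c n))
        (fun n => max 1 (expBucket α (N n) (c n))) :=
      subexpEq_max (B := fun _ => 1) (.refl _) (fun _ => zero_le_one) hE
        fun n => ⟨le_rfl, (one_mul _).ge⟩
    have hB : SubexpLE (fun n => ((decodingFactor n (P n).numCodewords + (5 * n + 3) : ℕ) : ℝ))
        (fun _ => 1) := by
      simp only [Nat.cast_add (decodingFactor _ _)]
      exact (decodingFactor_subexpLE hP).add_one (linear_subexpLE 5 3)
    exact (subexpEq_max hB (fun n => Nat.cast_nonneg _)
      (fun n => mul_nonneg (hfrac β n) (hE₁ n))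
      fun n => expQuery_bounds (P n) hα₀ hα₁ hβ₀ hβ₁ γ (N n) (q n) (c n)).trans
      ((SubexpEq.refl fun _ => 1).max
        ((hrβ.const_mul hC).mul hone (hfrac β) hE₁ (hrate β) hE₂)
        (fun _ => zero_le_one) (fun n => mul_nonneg (hfrac β n) (hE₁ n))
        (fun _ => zero_le_one) (fun n => mul_nonneg (hrate β n) (hE₂ n)))
  refine ⟨hbucket, fun h x D => ?_, fun h => ?_, fun h₁ h₂ q c => ?_,
    fun x D => ⟨hinsert x D, hremove x D⟩, hprep, hquery⟩
  · exact ⟨(hinsert x D).trans (.one_max h (hrate α)), (hremove x D).trans (.one_max h (hrate α))⟩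
  · simpa only [mul_assoc] using hprep.trans
      ((SubexpEq.one_max h (hrate α)).const_mul fun n => Nat.cast_nonneg (N n))
  · have hE : ∀ n, 0 ≤ expBucket α (N n) (c n) := fun n => expBucket_nonneg _ _ _
    -- The condition on `|L|` transfers to the expected bucket size through the first claim, so the
    -- inner maximum can be dropped.
    have hone := (SubexpEq.one_max (h₂.trans (hbucket c).2) hE)
    have hprod := hone.mul (SubexpEq.refl fun n => (P n).numFilters * rate β n)
      (fun n => zero_le_one.trans (le_max_left _ _)) (hrate β) hE (hrate β)
    simp only [mul_comm _ (_ * rate β _)] at hprod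
    refine (hquery q c).trans (.trans (.one_max ?_ fun n => ?_) hprod)
    -- The outer maximum goes too: the inner one is at least `1` and only enlarges the product.
    · refine h₁.trans (.of_le fun n => ?_)
      exact le_mul_of_one_le_right (hrate β n) (le_max_left _ _)
    · exact mul_nonneg (hrate β n) (zero_le_one.trans (le_max_left _ _))
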